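/- Let $\mathbb{T}^2=\mathbb{R}^2/\mathbb{Z}^2$ with Lebesgue (Haar) probability measure $\mu$, and let $\mathrm{End}^1_\mu(\mathbb{T}^2)$ be the set of $C^1$ local diffeomorphisms $f:\mathbb{T}^2\to\mathbb{T}^2$ that preserve $\mu$. For $f\in \mathrm{End}^1_\mu(\mathbb{T}^2)$ and $(x,u)$ in the unit tangent bundle $T^1\mathbb{T}^2$ put $$I(x,u;f^n)=\sum_{y\in f^{-n}(x)}\frac{\log\|(Df^n(y))^{-1}u\|}{|\det Df^n(y)|},\qquad C_\chi(f)=\sup_{n\ge 1}\ \inf_{(x,u)\in T^1\mathbb{T}^2}\ \frac1n I(x,u;f^n),$$ and let $\mathcal{U}=\{f\in \mathrm{End}^1_\mu(\mathbb{T}^2): C_\chi(f)>0\}$. For $E\in M_{2\times2}(\mathbb{Z})$ denote the induced endomorphism of $\mathbb{T}^2$ again by $E$, and let $[E]$ be the set of maps $g:\mathbb{T}^2\to\mathbb{T}^2$ for which there is a $C^1$ homotopy $[0,1]\times\mathbb{T}^2\to\mathbb{T}^2$ between $E$ and $g$. Then for every $E\in M_{2\times 2}(\mathbb{Z})$ that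 is not a homothety (that is, $E\ne k\cdot \mathrm{Id}$ for all $k\in\mathbb{R}$) and satisfies $|\det E|>2$, the intersection $[E]\cap\mathcal{U}$ is non-empty. -/

import Mathlib

open MeasureTheory Set

noncomputable section

namespace TorusEndo

/-- The Euclidean plane, which is also the tangent space of the torus at each of its points. -/
abbrev Plane : Type := EuclideanSpace ℝ (Fin 2)

/-- The torus `ℝ² / ℤ²`. Its `volume` is the Lebesgue (Haar) probability measure. -/
abbrev Torus : Type := UnitAddTorus (Fin 2)

/-- The universal covering `ℝ² → ℝ² / ℤ²`. -/
def proj (v : Plane) : Torus := fun i => ((v i : ℝ) : UnitAddCircle)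

/-- The representative of a point of the torus in the square `[-1/2, 1/2)²`; near `0` this is the
local inverse of the covering, that is, the standard chart of the torus centred at `0`. -/
def centredRep (z : Torus) : Plane :=
  WithLp.toLp 2 fun i => (AddCircle.equivIco (1 : ℝ) (-1 / 2) (z i) : ℝ)

/-- `f : 𝕋² → 𝕋²` is of class `C¹`: it has a `C¹` lift to the plane. -/
def IsC1 (f : Torus → Torus) : Prop :=
  ∃ F : Plane → Plane, ContDiff ℝ 1 F ∧ ∀ v, f (proj v) = proj (F v)

/-- The derivative `Df(x)`, computed in the translation charts centred at `x` and at `f x`. -/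
def torusDeriv (f : Torus → Torus) (x : Torus) : Plane →L[ℝ] Plane :=
  fderiv ℝ (fun w : Plane => centredRep (f (x + proj w) - f x)) 0

/-- A `C¹` homotopy from `f` to `g`: a map `[0,1] × 𝕋² → 𝕋²` with a `C¹` lift to
`[0,1] × ℝ²` that is `f` at time `0` and `g` at time `1`. -/
def C1Homotopic (f g : Torus → Torus) : Prop :=
  ∃ H : ℝ → Torus → Torus,
    (∃ F : ℝ × Plane → Plane, ContDiffOn ℝ 1 F (Icc (0 : ℝ) 1 ×ˢ univ) ∧
      ∀ t ∈ Icc (0 : ℝ) 1, ∀ v, H t (proj v) = proj (F (t, v))) ∧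
    H 0 = f ∧ H 1 = g

/-- The class `[f]` of all maps that are `C¹` homotopic to `f`. -/
def homotopyClass (f : Torus → Torus) : Set (Torus → Torus) :=
  {g | C1Homotopic f g}

/-- The endomorphism of the torus induced by an integer matrix. -/
def linearEndo (E : Matrix (Fin 2) (Fin 2) ℤ) : Torus → Torus :=
  fun x i => ∑ j, E i j • x j

/-- `E = k · Id` for some real number `k`. -/
def IsHomothety (E : Matrix (Fin 2) (Fin 2) ℤ) : Prop :=
  ∃ k : ℝ, E.map (fun a : ℤ => (a : ℝ)) = k • (1 : Matrix (Fin 2) (Fin 2) ℝ)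

/-- The set of `C¹` local diffeomorphisms of the torus (`C¹` maps with everywhere invertible
derivative) that preserve Lebesgue measure. -/
def EndMu1 : Set (Torus → Torus) :=
  {f | IsC1 f ∧ (∀ x, (torusDeriv f x).det ≠ 0) ∧
    MeasurePreserving f (volume : Measure Torus) volume}

/-- `I(x, u; g) = ∑_{y ∈ g⁻¹(x)} log ‖(Dg(y))⁻¹ u‖ / |det Dg(y)|`. The fibres of a local
diffeomorphism of the torus are finite, so that the sum is a finite one. -/
def backwardSum (g : Torus → Torus) (x : Torus) (u : Plane) : ℝ :=
  ∑ᶠ y ∈ g ⁻¹' {x}, Real.log ‖(torusDeriv g y).inverse u‖ / |(torusDeriv g y).det|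

/-- `C_χ(f) = sup_{n ≥ 1} inf_{(x, u)} I(x, u; fⁿ) / n`, where `(x, u)` runs over the unit tangent
bundle. The supremum and the infima are taken in the extended reals. -/
def Cchi (f : Torus → Torus) : EReal :=
  ⨆ (n : ℕ) (_ : 1 ≤ n), ⨅ (x : Torus) (u : Plane) (_ : ‖u‖ = 1),
    (((1 / (n : ℝ)) * backwardSum (f^[n]) x u : ℝ) : EReal)

/-- The set `𝒰 = {f : C_χ(f) > 0}` of endomorphisms. -/
def setU : Set (Torus → Torus) :=
  {f | f ∈ EndMu1 ∧ 0 < Cchi f}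

theorem proj_add (v w : Plane) : proj (v + w) = proj v + proj w := by
  ext i; simp [proj]

theorem proj_sub (v w : Plane) : proj (v - w) = proj v - proj w := by
  ext i; simp [proj]

theorem centredRep_proj {w : Plane} (hw : ‖w‖ < 1 / 2) : centredRep (proj w) = w := by
  ext i
  have h : |w i| < 1 / 2 := lt_of_le_of_lt (by simpa using PiLp.norm_apply_le w i) hw
  rw [abs_lt] at h
  have := AddCircle.equivIco_coe_eq (p := (1 : ℝ)) (a := -1 / 2) (x := w i)
    ⟨by linarith, by linarith⟩
  simp only [centredRep, proj]
  rw [this]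

/-- The derivative on the torus is the derivative of any lift. -/
theorem torusDeriv_proj {f : Torus → Torus} {F : Plane → Plane} {v : Plane}
    (hf : ∀ v, f (proj v) = proj (F v)) (hF : DifferentiableAt ℝ F v) :
    torusDeriv f (proj v) = fderiv ℝ F v := by
  have hc : ContinuousAt (fun w : Plane => F (v + w) - F v) 0 := by
    have h1 : ContinuousAt F (v + 0) := by simpa using hF.continuousAt
    have h2 : ContinuousAt (fun w : Plane => v + w) 0 := by fun_prop
    exact (ContinuousAt.comp (f := fun w : Plane => v + w) h1 h2).sub continuousAt_const
  have hev : (fun w : Plane => centredRep (f (proj v + proj w) - f (proj v)))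
      =ᶠ[nhds 0] fun w => F (v + w) - F v := by
    have hb : Metric.ball (0 : Plane) (1 / 2) ∈ nhds (F (v + 0) - F v) := by
      simpa using Metric.ball_mem_nhds (0 : Plane) (by norm_num : (0 : ℝ) < 1 / 2)
    filter_upwards [hc hb] with w hw
    rw [← proj_add, hf, hf, ← proj_sub]
    exact centredRep_proj (by simpa using hw)
  unfold torusDeriv
  rw [hev.fderiv_eq, fderiv_sub_const, fderiv_comp_add_left, add_zero]

end TorusEndo

end

/-!
The map is built from a linear map `E₁` conjugate to `E` and a strong shear `shear t r` in the
vertical direction: `conjEndo` is the conjugate of `shearEndo E₁ t r`, which is `E₁` after the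
shear. Letting the strength `t` of the shear tend to `0` gives the homotopy to `E`. The integer
change of basis is chosen by `exists_basisChange`: since `E` is not a homothety and `2 < |det E|`,
`E₁⁻¹` can be taken to move the vertical direction, and the kernel of `E₁` on the torus can be
taken not to be vertical.

Write `d = |det E₁|`. The determinant is constant, so the backward sum of the `n`-th iterate is an
`n`-fold average over the `d` preimages of a point (`backwardSum_conjEndo_succ`). Along one
backward step the derivative is inverted by `invDeriv`: `E₁⁻¹` followed by a shear of strength
`-t σ`, where `σ` is the slope of the profile of the shear at the preimage. Where `|σ| ≥ 1 / 2`, a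
vector that `E₁⁻¹` does not make almost vertical ("transverse") is stretched by a factor of order
`t`, and is transverse again, as the stretched vector is almost vertical and `E₁⁻¹` moves the
vertical direction. A vector that is not transverse is contracted by at most a factor of order `t`.
Because the fibres are not vertical, `exists_branch_sin_nonneg` and `exists_branch_sin_nonpos`
yield preimages at which the slopes have both signs, and one with the favourable sign makes the
vector transverse while contracting it by at most a bounded factor. With a bonus of `d log t` for
transverse vectors (`potential`), the average of the logarithm of the norm therefore grows by at
least `d⁻¹ log t - C` per step (`exists_potential_step`), where `C` does not depend on `t`.

This breaks down only in a fold, where the slope of the profile is close to `0`. A visit to it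
costs an amount of order `log t`, so it has to be shown that the frequency `foldFreq` with which
backward orbits visit the fold is small after finitely many steps, uniformly in the starting
point. For the triangle wave (`r = 1`) the fold consists of vertical lines. The points with an
`m`-th preimage in them lie on finitely many lines locally, whose slopes depend on the sign
of `σ` at the last step; hence, outside the finitely many intersections of lines with distinct
slopes, at least one preimage has no further preimages in the fold, and the frequency decreases
by the factor `1 - 1 / d` at each step (`exists_lines_foldFreq`). The finitely many exceptional
points contribute at most a multiple of `d⁻¹ ^ l` after `l` more steps
(`exists_foldFreq_one_lt`). Finally `foldFreq` is upper semicontinuous in `r` and the point, so the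
bound persists for a smooth profile with `r < 1` close to `1` (`exists_foldFreq_lt`).
-/

noncomputable section

namespace TorusEndo

/-! ### Linear endomorphisms of the plane and of the torus -/

/-- The action of a real matrix on the plane. -/
def planeMap (N : Matrix (Fin 2) (Fin 2) ℝ) : Plane →L[ℝ] Plane :=
  Matrix.toEuclideanCLM (n := Fin 2) (𝕜 := ℝ) N

theorem planeMap_apply (N : Matrix (Fin 2) (Fin 2) ℝ) (v : Plane) (i : Fin 2) :
    planeMap N v i = N i 0 * v 0 + N i 1 * v 1 := by
  have : (planeMap N v).ofLp = N.mulVec v.ofLp := rfl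
  rw [this]; simp [Matrix.mulVec, dotProduct, Fin.sum_univ_two]

theorem planeMap_mul (A B : Matrix (Fin 2) (Fin 2) ℝ) :
    planeMap (A * B) = (planeMap A).comp (planeMap B) := by
  simp only [planeMap, map_mul]; rfl

theorem planeMap_one : planeMap 1 = ContinuousLinearMap.id ℝ Plane := by
  simp only [planeMap, map_one]; rfl

theorem det_planeMap (N : Matrix (Fin 2) (Fin 2) ℝ) : (planeMap N).det = N.det := by
  have h : ((planeMap N : Plane →L[ℝ] Plane) : Plane →ₗ[ℝ] Plane) = Matrix.toEuclideanLin N := rfl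
  rw [ContinuousLinearMap.det, h, Matrix.toEuclideanLin_eq_toLin_orthonormal, LinearMap.det_toLin]

/-- An integer matrix, regarded as a real one. -/
abbrev toReal (A : Matrix (Fin 2) (Fin 2) ℤ) : Matrix (Fin 2) (Fin 2) ℝ :=
  A.map (Int.castRingHom ℝ)

theorem linearEndo_apply (A : Matrix (Fin 2) (Fin 2) ℤ) (x : Torus) (i : Fin 2) :
    linearEndo A x i = A i 0 • x 0 + A i 1 • x 1 := by
  simp [linearEndo, Fin.sum_univ_two]

theorem linearEndo_proj (A : Matrix (Fin 2) (Fin 2) ℤ) (v : Plane) :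
    linearEndo A (proj v) = proj (planeMap (toReal A) v) := by
  ext i
  rw [linearEndo_apply]
  simp [proj, planeMap_apply]

theorem linearEndo_mul (A B : Matrix (Fin 2) (Fin 2) ℤ) (x : Torus) :
    linearEndo (A * B) x = linearEndo A (linearEndo B x) := by
  ext i
  simp only [linearEndo_apply, Matrix.mul_apply, Fin.sum_univ_two, add_smul, smul_add, mul_smul]
  abel

theorem linearEndo_one (x : Torus) : linearEndo 1 x = x := by
  ext i
  fin_cases i <;> simp [linearEndo_apply]

theorem linearEndo_add (A : Matrix (Fin 2) (Fin 2) ℤ) (x y : Torus) :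
    linearEndo A (x + y) = linearEndo A x + linearEndo A y := by
  ext i
  simp only [linearEndo_apply, Pi.add_apply, smul_add]
  abel

theorem proj_surjective : Function.Surjective proj := by
  intro x
  refine ⟨WithLp.toLp 2 fun i => (AddCircle.equivIco (1 : ℝ) 0 (x i) : ℝ), ?_⟩
  ext i
  simp [proj]

/-- Every point of the torus has a lift in a fixed bounded region. -/
theorem exists_bounded_lift (x : Torus) : ∃ v : Plane, proj v = x ∧ ‖v‖ ≤ 2 := by
  refine ⟨WithLp.toLp 2 fun i => (AddCircle.equivIco (1 : ℝ) 0 (x i) : ℝ), ?_, ?_⟩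
  · ext i
    simp [proj]
  · rw [EuclideanSpace.norm_eq, Fin.sum_univ_two]
    have h : ∀ i, ‖((AddCircle.equivIco (1 : ℝ) 0 (x i) : ℝ))‖ ^ 2 ≤ 1 := by
      intro i
      have := (AddCircle.equivIco (1 : ℝ) 0 (x i)).2
      rw [Real.norm_eq_abs, sq_abs]
      nlinarith [this.1, this.2]
    rw [Real.sqrt_le_left (by norm_num)]
    have h0 := h 0
    have h1 := h 1
    simp only at h0 h1 ⊢
    linarith

/-- A linear endomorphism of the torus as a homomorphism. -/
def linearHom (A : Matrix (Fin 2) (Fin 2) ℤ) : Torus →+ Torus where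
  toFun := linearEndo A
  map_zero' := by ext i; simp [linearEndo_apply]
  map_add' := linearEndo_add A

theorem continuous_linearEndo (A : Matrix (Fin 2) (Fin 2) ℤ) : Continuous (linearEndo A) := by
  unfold linearEndo
  fun_prop

theorem toReal_det (A : Matrix (Fin 2) (Fin 2) ℤ) : (toReal A).det = (A.det : ℝ) := by
  simp [Matrix.det_fin_two]

theorem toReal_mul_inv {A : Matrix (Fin 2) (Fin 2) ℤ} (hA : A.det ≠ 0) :
    toReal A * (toReal A)⁻¹ = 1 :=
  Matrix.mul_nonsing_inv _ (by rw [toReal_det]; simpa using hA)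

theorem inv_mul_toReal {A : Matrix (Fin 2) (Fin 2) ℤ} (hA : A.det ≠ 0) :
    (toReal A)⁻¹ * toReal A = 1 :=
  Matrix.nonsing_inv_mul _ (by rw [toReal_det]; simpa using hA)

theorem planeMap_toReal_inv {A : Matrix (Fin 2) (Fin 2) ℤ} (hA : A.det ≠ 0) (v : Plane) :
    planeMap (toReal A) (planeMap (toReal A)⁻¹ v) = v := by
  have := congrArg (fun f => f v) (planeMap_mul (toReal A) (toReal A)⁻¹)
  rw [toReal_mul_inv hA, planeMap_one] at this
  exact this.symm

theorem linearEndo_surjective {A : Matrix (Fin 2) (Fin 2) ℤ} (hA : A.det ≠ 0) :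
    Function.Surjective (linearEndo A) := by
  intro x
  obtain ⟨v, rfl⟩ := proj_surjective x
  exact ⟨proj (planeMap (toReal A)⁻¹ v), by rw [linearEndo_proj, planeMap_toReal_inv hA]⟩

theorem measurePreserving_linearEndo {A : Matrix (Fin 2) (Fin 2) ℤ} (hA : A.det ≠ 0) :
    MeasurePreserving (linearEndo A) (volume : Measure Torus) volume := by
  have := (linearHom A).measurePreserving (μ := (volume : Measure Torus)) (ν := volume)
    (continuous_linearEndo A) (linearEndo_surjective hA) rfl
  exact this

/-- The fibres of the endomorphism of the torus induced by `A` are the cosets of this group. -/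
abbrev fibreGroup (A : Matrix (Fin 2) (Fin 2) ℤ) : AddSubgroup Torus := (linearHom A).ker

theorem mem_fibreGroup {A : Matrix (Fin 2) (Fin 2) ℤ} {x : Torus} :
    x ∈ fibreGroup A ↔ linearEndo A x = 0 := Iff.rfl

theorem coe_eq_zero_iff (a : ℝ) : ((a : ℝ) : UnitAddCircle) = 0 ↔ ∃ n : ℤ, (n : ℝ) = a := by
  rw [AddCircle.coe_eq_zero_iff]; simp

/-- `n ↦ A⁻¹ n` as a homomorphism from `ℤ²` to the torus. -/
def invHom (A : Matrix (Fin 2) (Fin 2) ℤ) : (Fin 2 → ℤ) →+ Torus where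
  toFun n := proj (planeMap (toReal A)⁻¹ (WithLp.toLp 2 fun i => (n i : ℝ)))
  map_zero' := by
    ext i; simp [proj, planeMap_apply]
  map_add' m n := by
    rw [← proj_add, ← map_add]; congr 2; ext i; simp

theorem range_invHom {A : Matrix (Fin 2) (Fin 2) ℤ} (hA : A.det ≠ 0) :
    (invHom A).range = fibreGroup A := by
  ext x
  rw [AddMonoidHom.mem_range, mem_fibreGroup]
  constructor
  · rintro ⟨n, rfl⟩
    change linearEndo A (proj _) = 0
    rw [linearEndo_proj, planeMap_toReal_inv hA]
    ext i
    simp only [proj]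
    exact (coe_eq_zero_iff _).2 ⟨n i, rfl⟩
  · intro hx
    obtain ⟨v, rfl⟩ := proj_surjective x
    rw [linearEndo_proj] at hx
    have h : ∀ i, ∃ n : ℤ, (n : ℝ) = planeMap (toReal A) v i := fun i =>
      (coe_eq_zero_iff _).1 (congrFun hx i)
    choose n hn using h
    refine ⟨n, ?_⟩
    change proj (planeMap _ _) = _
    have : (WithLp.toLp 2 fun i => (n i : ℝ) : Plane) = planeMap (toReal A) v := by
      ext i; exact hn i
    rw [this, ← ContinuousLinearMap.comp_apply, ← planeMap_mul, inv_mul_toReal hA, planeMap_one]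
    rfl

theorem ker_invHom {A : Matrix (Fin 2) (Fin 2) ℤ} (hA : A.det ≠ 0) :
    (invHom A).ker = (LinearMap.range (Matrix.toLin' A)).toAddSubgroup := by
  ext n
  rw [AddMonoidHom.mem_ker]
  change _ ↔ n ∈ LinearMap.range (Matrix.toLin' A)
  rw [LinearMap.mem_range]
  constructor
  · intro h
    have h' : ∀ i, ∃ m : ℤ, (m : ℝ) =
        planeMap (toReal A)⁻¹ (WithLp.toLp 2 fun i => (n i : ℝ)) i := fun i =>
      (coe_eq_zero_iff _).1 (congrFun h i)
    choose m hm using h'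
    refine ⟨m, ?_⟩
    have h2 : planeMap (toReal A) (WithLp.toLp 2 fun i => (m i : ℝ)) =
        (WithLp.toLp 2 fun i => (n i : ℝ) : Plane) := by
      rw [← planeMap_toReal_inv hA (WithLp.toLp 2 fun i => (n i : ℝ))]
      congr 1; ext i; exact hm i
    ext i
    have h3 := congrArg (fun v : Plane => v i) h2
    simp only [planeMap_apply] at h3
    simp only [Matrix.toLin'_apply, Matrix.mulVec, dotProduct, Fin.sum_univ_two]
    simp only [Matrix.map_apply, Int.coe_castRingHom] at h3
    exact_mod_cast h3
  · rintro ⟨m, rfl⟩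
    have h2 : (WithLp.toLp 2 fun i => ((Matrix.toLin' A m i : ℤ) : ℝ) : Plane) =
        planeMap (toReal A) (WithLp.toLp 2 fun i => (m i : ℝ)) := by
      ext i
      simp [planeMap_apply, Matrix.mulVec, dotProduct, Fin.sum_univ_two]
    change proj (planeMap _ _) = 0
    rw [h2, ← ContinuousLinearMap.comp_apply, ← planeMap_mul, inv_mul_toReal hA, planeMap_one]
    ext i
    exact (coe_eq_zero_iff _).2 ⟨m i, rfl⟩

/-- The degree of a linear endomorphism of the torus is its determinant, up to sign. -/
theorem card_fibreGroup {A : Matrix (Fin 2) (Fin 2) ℤ} (hA : A.det ≠ 0) :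
    Nat.card (fibreGroup A) = A.det.natAbs := by
  rw [← range_invHom hA, ← Nat.card_congr
    (QuotientAddGroup.quotientKerEquivRange (invHom A)).toEquiv, ker_invHom hA]
  have hinj : Function.Injective (Matrix.toLin' A) := by
    rw [← LinearMap.ker_eq_bot]
    exact Matrix.ker_toLin'_eq_bot_iff.2 fun v hv => by
      by_contra h; exact hA (Matrix.exists_mulVec_eq_zero_iff.1 ⟨v, h, hv⟩)
  have := Submodule.natAbs_det_equiv (LinearMap.range (Matrix.toLin' A))
    (LinearEquiv.ofInjective (Matrix.toLin' A) hinj)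
  rw [← LinearMap.det_toLin' A]
  refine Eq.trans ?_ (this.symm.trans ?_)
  · rfl
  · congr 1

theorem finite_fibreGroup {A : Matrix (Fin 2) (Fin 2) ℤ} (hA : A.det ≠ 0) :
    Finite (fibreGroup A) :=
  Nat.finite_of_card_ne_zero (by rw [card_fibreGroup hA]; simpa using hA)

/-! ### The direction of the shear -/

/-- A matrix of determinant one whose second column is `(1, n)`. -/
def basisChange (n : ℤ) : Matrix (Fin 2) (Fin 2) ℤ := !![0, 1; -1, n]

/-- The inverse of `basisChange n`. -/
def basisChangeInv (n : ℤ) : Matrix (Fin 2) (Fin 2) ℤ := !![n, -1; 1, 0]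

theorem basisChange_mul_inv (n : ℤ) : basisChange n * basisChangeInv n = 1 := by
  ext i j; fin_cases i <;> fin_cases j <;> simp [basisChange, basisChangeInv]

theorem basisChange_inv_mul (n : ℤ) : basisChangeInv n * basisChange n = 1 := by
  ext i j; fin_cases i <;> fin_cases j <;> simp [basisChange, basisChangeInv]

/-- For a matrix which is not a homothety there is a basis of `ℤ²` whose second vector is not an
eigenvector and is not mapped to a multiple of the determinant. Indeed a quadratic polynomial has
at most two roots, and two vectors that form a basis are not both mapped to multiples of the
determinant `D`, as `D ^ 2` does not divide `D`. -/
theorem exists_basisChange {E : Matrix (Fin 2) (Fin 2) ℤ} (hE : ¬ IsHomothety E)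
    (hdet : 2 < |E.det|) :
    ∃ n : ℤ, (basisChangeInv n * E * basisChange n) 0 1 ≠ 0 ∧
      ¬ (E.det ∣ (basisChangeInv n * E * basisChange n) 0 1 ∧
        E.det ∣ (basisChangeInv n * E * basisChange n) 1 1) := by
  set a := E 0 0 with ha
  set b := E 0 1 with hb
  set c := E 1 0 with hc
  set e := E 1 1 with he
  have hE' : E = !![a, b; c, e] := by
    ext i j; fin_cases i <;> fin_cases j <;> rfl
  have h01 : ∀ n, (basisChangeInv n * E * basisChange n) 0 1 = n * (a + b * n) - (c + e * n) := by
    intro n; rw [hE']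
    simp [basisChange, basisChangeInv]; ring
  have h11 : ∀ n, (basisChangeInv n * E * basisChange n) 1 1 = a + b * n := by
    intro n; rw [hE']
    simp [basisChange, basisChangeInv]
  have hD : E.det = a * e - b * c := by rw [Matrix.det_fin_two]
  set D := E.det
  have hD0 : D ≠ 0 := by intro h; rw [h] at hdet; simp at hdet
  by_contra hcon
  push Not at hcon
  simp only [h01, h11] at hcon
  -- of two consecutive integers at least one is a root
  have key : ∀ n : ℤ, n * (a + b * n) - (c + e * n) = 0 ∨
      (n + 1) * (a + b * (n + 1)) - (c + e * (n + 1)) = 0 := by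
    intro n
    by_contra hn
    push Not at hn
    obtain ⟨h1, h2⟩ := hcon n hn.1
    obtain ⟨h3, h4⟩ := hcon (n + 1) hn.2
    have hb' : D ∣ b := by have := dvd_sub h4 h2; ring_nf at this; exact this
    have ha' : D ∣ a := by have := dvd_sub h2 (hb'.mul_right n); ring_nf at this; exact this
    have h5 : D ∣ c + e * n := by
      have := dvd_sub (h2.mul_left n) h1; ring_nf at this ⊢; exact this
    have h6 : D ∣ c + e * (n + 1) := by
      have := dvd_sub (h4.mul_left (n + 1)) h3; ring_nf at this ⊢; exact this
    have he' : D ∣ e := by have := dvd_sub h6 h5; ring_nf at this; exact this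
    have hc' : D ∣ c := by have := dvd_sub h5 (he'.mul_right n); ring_nf at this; exact this
    have : D * D ∣ D := by
      conv_rhs => rw [hD]
      exact dvd_sub (mul_dvd_mul ha' he') (mul_dvd_mul hb' hc')
    have h7 : D ∣ 1 := (mul_dvd_mul_iff_left hD0).1 (by simpa using this)
    rcases Int.isUnit_iff.1 (isUnit_of_dvd_one h7) with h8 | h8 <;>
      · rw [h8] at hdet
        norm_num at hdet
  have k0 := key 0
  have k2 := key 2
  have k4 := key 4
  norm_num at k0 k2 k4
  have hz : b = 0 ∧ c = 0 ∧ a = e := by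
    rcases k0 with h | h <;> rcases k2 with h' | h' <;> rcases k4 with h'' | h'' <;>
      refine ⟨?_, ?_, ?_⟩ <;> linarith
  refine hE ⟨a, ?_⟩
  rw [hE', hz.1, hz.2.1, ← hz.2.2]
  ext i j; fin_cases i <;> fin_cases j <;> simp

/-! ### The profile of the shear -/

/-- A family of `1`-periodic functions. For `0 < r < 1` it is smooth; for `r = 1` it is the
triangle wave, with slopes `1` and `-1`. -/
def profile (r x : ℝ) : ℝ := Real.arccos (r * Real.cos (2 * Real.pi * x)) / (2 * Real.pi)

/-- The derivative of `profile r`, for `0 < r < 1`. -/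
def profileSlope (r x : ℝ) : ℝ :=
  r * Real.sin (2 * Real.pi * x) / √(1 - (r * Real.cos (2 * Real.pi * x)) ^ 2)

theorem continuous_profile : Continuous fun q : ℝ × ℝ => profile q.1 q.2 := by
  unfold profile
  have := Real.continuous_arccos
  fun_prop

theorem profile_periodic (r : ℝ) : Function.Periodic (profile r) 1 := by
  intro x
  simp only [profile]
  rw [mul_add, mul_one, Real.cos_add_two_pi]

theorem abs_mul_cos_lt {r : ℝ} (hr0 : 0 < r) (hr1 : r < 1) (θ : ℝ) : |r * Real.cos θ| < 1 := by
  rw [abs_mul, abs_of_pos hr0]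
  calc r * |Real.cos θ| ≤ r * 1 := by gcongr; exact Real.abs_cos_le_one θ
    _ < 1 := by simpa

theorem contDiff_profile {r : ℝ} (hr0 : 0 < r) (hr1 : r < 1) : ContDiff ℝ 1 (profile r) := by
  unfold profile
  refine ContDiff.div_const ?_ _
  rw [contDiff_iff_contDiffAt]
  intro x
  have h := abs_lt.1 (abs_mul_cos_lt hr0 hr1 (2 * Real.pi * x))
  have h1 : ContDiffAt ℝ 1 Real.arccos (r * Real.cos (2 * Real.pi * x)) :=
    Real.contDiffAt_arccos h.1.ne' h.2.ne
  have h2 : ContDiffAt ℝ 1 (fun x : ℝ => r * Real.cos (2 * Real.pi * x)) x := by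
    have : ContDiff ℝ 1 (fun x : ℝ => r * Real.cos (2 * Real.pi * x)) := by fun_prop
    exact this.contDiffAt
  exact ContDiffAt.comp (g := Real.arccos) x h1 h2

theorem hasDerivAt_profile {r : ℝ} (hr0 : 0 < r) (hr1 : r < 1) (x : ℝ) :
    HasDerivAt (profile r) (profileSlope r x) x := by
  have h := abs_lt.1 (abs_mul_cos_lt hr0 hr1 (2 * Real.pi * x))
  have h1 := Real.hasDerivAt_arccos h.1.ne' h.2.ne
  have h2 : HasDerivAt (fun x : ℝ => r * Real.cos (2 * Real.pi * x))
      (r * (-Real.sin (2 * Real.pi * x) * (2 * Real.pi))) x := by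
    have h3 : HasDerivAt (fun x : ℝ => 2 * Real.pi * x) (2 * Real.pi) x := by
      simpa using (hasDerivAt_id x).const_mul (2 * Real.pi)
    exact ((Real.hasDerivAt_cos _).comp x h3).const_mul r
  have h4 := (h1.comp x h2).div_const (2 * Real.pi)
  refine h4.congr_deriv ?_
  have := Real.pi_pos
  unfold profileSlope
  field_simp

theorem abs_profileSlope_le {r : ℝ} (hr0 : 0 < r) (hr1 : r < 1) (x : ℝ) :
    |profileSlope r x| ≤ 1 := by
  have h := (sq_lt_one_iff_abs_lt_one _).2 (abs_mul_cos_lt hr0 hr1 (2 * Real.pi * x))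
  have hs := Real.sin_sq_add_cos_sq (2 * Real.pi * x)
  unfold profileSlope
  rw [abs_div, abs_of_nonneg (Real.sqrt_nonneg _), div_le_one (Real.sqrt_pos.2 (by linarith))]
  apply Real.abs_le_sqrt
  have h1 : (r * Real.sin (2 * Real.pi * x)) ^ 2 + (r * Real.cos (2 * Real.pi * x)) ^ 2 = r ^ 2 := by
    rw [mul_pow, mul_pow, ← mul_add, hs, mul_one]
  nlinarith

/-- Where the sine is not small, the slope of the profile is bounded away from zero and has the
sign of the sine. -/
theorem half_le_abs_profileSlope {r : ℝ} (hr0 : 0 < r) (hr1 : r < 1) (hr2 : 1 / 2 ≤ r ^ 2) {x : ℝ}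
    (hx : 1 - r ^ 2 < Real.sin (2 * Real.pi * x) ^ 2) :
    1 / 2 ≤ |profileSlope r x| ∧ 0 ≤ profileSlope r x * Real.sin (2 * Real.pi * x) := by
  have h := (sq_lt_one_iff_abs_lt_one _).2 (abs_mul_cos_lt hr0 hr1 (2 * Real.pi * x))
  have hs := Real.sin_sq_add_cos_sq (2 * Real.pi * x)
  constructor
  · unfold profileSlope
    rw [abs_div, abs_of_nonneg (Real.sqrt_nonneg _), le_div_iff₀ (Real.sqrt_pos.2 (by linarith))]
    rw [← Real.sqrt_sq_eq_abs]
    have : (1 / 2 : ℝ) = √(1 / 4) := by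
      rw [show (1 / 4 : ℝ) = (1 / 2) ^ 2 by norm_num, Real.sqrt_sq (by norm_num)]
    rw [this, ← Real.sqrt_mul (by norm_num)]
    apply Real.sqrt_le_sqrt
    nlinarith [sq_nonneg (Real.sin (2 * Real.pi * x)), sq_nonneg (Real.cos (2 * Real.pi * x))]
  · unfold profileSlope
    rw [div_mul_eq_mul_div]
    apply div_nonneg _ (Real.sqrt_nonneg _)
    nlinarith [mul_nonneg hr0.le (sq_nonneg (Real.sin (2 * Real.pi * x)))]

theorem profile_neg (r x : ℝ) : profile r (-x) = profile r x := by
  simp [profile]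

/-- Where the sine is nonnegative, the triangle wave has slope `1`. -/
theorem profile_one_of_sin_nonneg {x : ℝ} (hx : 0 ≤ Real.sin (2 * Real.pi * x)) :
    ∃ n : ℤ, |(n : ℝ)| ≤ |x| + 1 ∧ profile 1 x = x - n := by
  have hpi := Real.pi_pos
  refine ⟨⌊x⌋, ?_, ?_⟩
  · have h1 := Int.floor_le x
    have h2 := Int.lt_floor_add_one x
    rw [abs_le]
    constructor <;> cases abs_cases x <;> linarith
  · have hfl : x - ⌊x⌋ = Int.fract x := rfl
    have h0 := Int.fract_nonneg x
    have h1 := Int.fract_lt_one x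
    have e1 : Real.sin (2 * Real.pi * x) = Real.sin (2 * Real.pi * Int.fract x) := by
      rw [← hfl, mul_sub, show 2 * Real.pi * (⌊x⌋ : ℝ) = (⌊x⌋ : ℝ) * (2 * Real.pi) by ring,
        Real.sin_sub_int_mul_two_pi]
    have e2 : Real.cos (2 * Real.pi * x) = Real.cos (2 * Real.pi * Int.fract x) := by
      rw [← hfl, mul_sub, show 2 * Real.pi * (⌊x⌋ : ℝ) = (⌊x⌋ : ℝ) * (2 * Real.pi) by ring,
        Real.cos_sub_int_mul_two_pi]
    have h2 : Int.fract x ≤ 1 / 2 := by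
      by_contra hlt
      push Not at hlt
      have : Real.sin (2 * Real.pi * Int.fract x - 2 * Real.pi) < 0 :=
        Real.sin_neg_of_neg_of_neg_pi_lt (by nlinarith) (by nlinarith)
      rw [Real.sin_sub_two_pi] at this
      linarith
    rw [hfl]
    unfold profile
    rw [one_mul, e2, Real.arccos_cos (by positivity) (by nlinarith)]
    field_simp

/-- Where the sine is nonpositive, the triangle wave has slope `-1`. -/
theorem profile_one_of_sin_nonpos {x : ℝ} (hx : Real.sin (2 * Real.pi * x) ≤ 0) :
    ∃ n : ℤ, |(n : ℝ)| ≤ |x| + 1 ∧ profile 1 x = -x - n := by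
  rw [← profile_neg, ← abs_neg x]
  apply profile_one_of_sin_nonneg
  rw [mul_neg, Real.sin_neg]
  linarith

/-! ### The shear -/

/-- The shear `(x, y) ↦ (x, y + t · profile r x)` of the plane. -/
def shearLift (t r : ℝ) (v : Plane) : Plane :=
  v + (t * profile r (v 0)) • EuclideanSpace.single (1 : Fin 2) (1 : ℝ)

theorem shearLift_zero (t r : ℝ) (v : Plane) : shearLift t r v 0 = v 0 := by
  simp [shearLift]

theorem shearLift_one (t r : ℝ) (v : Plane) :
    shearLift t r v 1 = v 1 + t * profile r (v 0) := by
  simp [shearLift]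

theorem plane_ext {v w : Plane} (h0 : v 0 = w 0) (h1 : v 1 = w 1) : v = w := by
  ext i; fin_cases i <;> assumption

theorem shearLift_neg_shearLift (t r : ℝ) (v : Plane) :
    shearLift (-t) r (shearLift t r v) = v := by
  apply plane_ext <;> simp [shearLift_zero, shearLift_one]

/-- The shear `(x, y) ↦ (x, y + t · profile r x)` of the torus. -/
def shear (t r : ℝ) (x : Torus) : Torus :=
  x + proj ((t * (profile_periodic r).lift (x 0)) • EuclideanSpace.single (1 : Fin 2) (1 : ℝ))

theorem shear_proj (t r : ℝ) (v : Plane) : shear t r (proj v) = proj (shearLift t r v) := by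
  rw [shear, shearLift, proj_add]
  congr 3

theorem shear_neg_shear (t r : ℝ) (x : Torus) : shear (-t) r (shear t r x) = x := by
  obtain ⟨v, rfl⟩ := proj_surjective x
  rw [shear_proj, shear_proj, shearLift_neg_shearLift]

theorem shear_shear_neg (t r : ℝ) (x : Torus) : shear t r (shear (-t) r x) = x := by
  simpa using shear_neg_shear (-t) r x

theorem shear_zero_left (r : ℝ) (x : Torus) : shear 0 r x = x := by
  obtain ⟨v, rfl⟩ := proj_surjective x
  rw [shear_proj]
  simp [shearLift]

theorem continuous_profile_right (r : ℝ) : Continuous (profile r) := by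
  unfold profile
  have := Real.continuous_arccos
  fun_prop

theorem measurePreserving_shear (t r : ℝ) :
    MeasurePreserving (shear t r) (volume : Measure Torus) volume := by
  have hp : Continuous (profile_periodic r).lift := continuous_coinduced_dom.2 (by
    exact continuous_profile_right r)
  let g : UnitAddCircle → UnitAddCircle → UnitAddCircle := fun a b =>
    b + ((t * (profile_periodic r).lift a : ℝ) : UnitAddCircle)
  have hg : Continuous (Function.uncurry g) := by
    have h1 : Continuous fun a : UnitAddCircle =>
        ((t * (profile_periodic r).lift a : ℝ) : UnitAddCircle) :=
      (AddCircle.continuous_mk' 1).comp (continuous_const.mul hp)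
    exact continuous_snd.add (h1.comp continuous_fst)
  have h1 : MeasurePreserving (fun p : UnitAddCircle × UnitAddCircle => (p.1, g p.1 p.2))
      ((volume : Measure UnitAddCircle).prod volume) (volume.prod volume) :=
    (MeasurePreserving.id volume).skew_product hg.measurable
      (Filter.Eventually.of_forall fun a => map_add_right_eq_self volume _)
  have e := volume_preserving_finTwoArrow UnitAddCircle
  have h2 := (e.symm MeasurableEquiv.finTwoArrow).comp (h1.comp e)
  have h3 : shear t r = MeasurableEquiv.finTwoArrow.symm ∘
      (fun p : UnitAddCircle × UnitAddCircle => (p.1, g p.1 p.2)) ∘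
      MeasurableEquiv.finTwoArrow := by
    funext x
    ext i
    fin_cases i
    · simp [shear, proj, MeasurableEquiv.finTwoArrow]
    · simp [shear, proj, MeasurableEquiv.finTwoArrow, g]
  rw [h3]
  exact h2

/-- The derivative of the shear, for the slope `σ` of the profile. -/
def shearMatrix (t σ : ℝ) : Matrix (Fin 2) (Fin 2) ℝ := !![1, 0; t * σ, 1]

theorem hasFDerivAt_shearLift (t : ℝ) {r : ℝ} (hr0 : 0 < r) (hr1 : r < 1) (v : Plane) :
    HasFDerivAt (shearLift t r) (planeMap (shearMatrix t (profileSlope r (v 0)))) v := by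
  have h0 : HasFDerivAt (fun v : Plane => v 0)
      (EuclideanSpace.proj (0 : Fin 2) : Plane →L[ℝ] ℝ) v :=
    (EuclideanSpace.proj (0 : Fin 2) : Plane →L[ℝ] ℝ).hasFDerivAt
  have h1 := (((hasDerivAt_profile hr0 hr1 (v 0)).comp_hasFDerivAt v h0).const_mul t).smul_const
    (EuclideanSpace.single (1 : Fin 2) (1 : ℝ))
  have h2 := (hasFDerivAt_id v).add h1
  refine h2.congr_fderiv ?_
  ext w i
  fin_cases i
  · simp [planeMap_apply, shearMatrix]
  · simp [planeMap_apply, shearMatrix]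
    ring

theorem contDiff_shearLift {r : ℝ} (hr0 : 0 < r) (hr1 : r < 1) :
    ContDiff ℝ 1 fun q : ℝ × Plane => shearLift q.1 r q.2 := by
  unfold shearLift
  have h0 : ContDiff ℝ 1 fun q : ℝ × Plane => q.2 0 :=
    (EuclideanSpace.proj (0 : Fin 2) : Plane →L[ℝ] ℝ).contDiff.comp contDiff_snd
  have h := (contDiff_profile hr0 hr1).comp h0
  exact contDiff_snd.add ((contDiff_fst.mul h).smul contDiff_const)

theorem continuous_shearLift (t : ℝ) :
    Continuous fun q : ℝ × Plane => shearLift t q.1 q.2 := by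
  unfold shearLift
  have h0 : Continuous fun q : ℝ × Plane => (q.1, q.2 0) := by fun_prop
  have h := continuous_profile.comp h0
  have h' : Continuous fun q : ℝ × Plane => profile q.1 (q.2 0) := h
  fun_prop

/-! ### The recursion for the backward sums -/

theorem iterate_proj {f : Torus → Torus} {F : Plane → Plane} (hf : ∀ v, f (proj v) = proj (F v))
    (n : ℕ) (v : Plane) : f^[n] (proj v) = proj (F^[n] v) := by
  induction n with
  | zero => rfl
  | succ n ih => rw [Function.iterate_succ_apply', Function.iterate_succ_apply', ih, hf]

theorem finite_iterate_preimage {f : Torus → Torus} (h : ∀ x, (f ⁻¹' {x}).Finite) (n : ℕ)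
    (x : Torus) : (f^[n] ⁻¹' {x}).Finite := by
  induction n with
  | zero => simp
  | succ n ih =>
    rw [Function.iterate_succ, preimage_comp]
    exact ih.preimage' fun b _ => h b

theorem backwardSum_zero (f : Torus → Torus) (x : Torus) (u : Plane) :
    backwardSum f^[0] x u = Real.log ‖u‖ := by
  have h : torusDeriv id x = ContinuousLinearMap.id ℝ Plane := by
    obtain ⟨v, rfl⟩ := proj_surjective x
    rw [torusDeriv_proj (F := id) (fun _ => rfl) differentiableAt_id, fderiv_id]
  have hdet : (ContinuousLinearMap.id ℝ Plane).det = 1 := by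
    rw [ContinuousLinearMap.det]; exact LinearMap.det_id
  simp only [backwardSum, Function.iterate_zero, preimage_id]
  rw [finsum_mem_singleton, h, ContinuousLinearMap.inverse_id, hdet]
  simp

/-- The backward sum of `f ^ (n + 1)` at `x` is an average of the backward sums of `f ^ n` at the
preimages of `x` under `f`, by the chain rule. -/
theorem backwardSum_succ {f : Torus → Torus} {F : Plane → Plane}
    (hf : ∀ v, f (proj v) = proj (F v)) (hF : Differentiable ℝ F) {A : Plane → Plane →L[ℝ] Plane}
    (hA : ∀ v, (fderiv ℝ F v).comp (A v) = ContinuousLinearMap.id ℝ Plane)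
    (hA' : ∀ v, (A v).comp (fderiv ℝ F v) = ContinuousLinearMap.id ℝ Plane) {d : ℝ}
    (hd : ∀ v, |(fderiv ℝ F v).det| = d) (hfin : ∀ x, (f ⁻¹' {x}).Finite)
    {ι : Type*} [Fintype ι] {x : Torus} {β : ι → Plane}
    (hβ : f ⁻¹' {x} = range fun k => proj (β k)) (hinj : Function.Injective fun k => proj (β k))
    (n : ℕ) (u : Plane) :
    backwardSum f^[n + 1] x u = d⁻¹ * ∑ k, backwardSum f^[n] (proj (β k)) (A (β k) u) := by
  have hset : f^[n + 1] ⁻¹' {x} = ⋃ k, f^[n] ⁻¹' {proj (β k)} := by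
    rw [Function.iterate_succ', preimage_comp, hβ]
    ext z; simp [eq_comm]
  have hFn : ∀ n, Differentiable ℝ F^[n] := fun n => hF.iterate n
  unfold backwardSum
  rw [hset, finsum_mem_iUnion, finsum_eq_sum_of_fintype, Finset.mul_sum]
  · refine Finset.sum_congr rfl fun k _ => ?_
    rw [← smul_eq_mul, smul_finsum_mem (finite_iterate_preimage hfin n _)]
    refine finsum_mem_congr rfl fun z hz => ?_
    obtain ⟨v, rfl⟩ := proj_surjective z
    have hz' : proj (F^[n] v) = proj (β k) := by rw [← iterate_proj hf]; exact hz
    have hD : fderiv ℝ F (F^[n] v) = fderiv ℝ F (β k) := by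
      rw [← torusDeriv_proj hf hF.differentiableAt, hz', torusDeriv_proj hf hF.differentiableAt]
    have hchain : torusDeriv f^[n + 1] (proj v) =
        (fderiv ℝ F (β k)).comp (torusDeriv f^[n] (proj v)) := by
      rw [torusDeriv_proj (iterate_proj hf (n + 1)) (hFn _).differentiableAt,
        torusDeriv_proj (iterate_proj hf n) (hFn _).differentiableAt, ← hD,
        Function.iterate_succ']
      exact fderiv_comp v hF.differentiableAt (hFn n).differentiableAt
    let e : Plane ≃L[ℝ] Plane := ContinuousLinearEquiv.equivOfInverse' _ _ (hA (β k)) (hA' (β k))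
    have he : fderiv ℝ F (β k) = (e : Plane →L[ℝ] Plane) := rfl
    have hdet : (torusDeriv f^[n + 1] (proj v)).det =
        (fderiv ℝ F (β k)).det * (torusDeriv f^[n] (proj v)).det := by
      rw [hchain]
      exact LinearMap.det_comp _ _
    rw [hdet, hchain, abs_mul, hd, he, ContinuousLinearMap.inverse_equiv_comp]
    have : ((torusDeriv f^[n] (proj v)).inverse ∘SL (e.symm : Plane →L[ℝ] Plane)) u =
        (torusDeriv f^[n] (proj v)).inverse (A (β k) u) := rfl
    rw [this, smul_eq_mul]
    field_simp
  · intro k l hkl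
    refine Set.disjoint_left.2 fun z hz hz' => hkl (hinj ?_)
    exact (show f^[n] z = _ from hz).symm.trans hz'
  · exact fun k => finite_iterate_preimage hfin n _

/-! ### The maps and their fibres -/

/-- The shear followed by the linear endomorphism. -/
def shearEndo (E₁ : Matrix (Fin 2) (Fin 2) ℤ) (t r : ℝ) (x : Torus) : Torus :=
  linearEndo E₁ (shear t r x)

/-- A lift of an element of `fibreGroup A`. -/
def fibreLift {A : Matrix (Fin 2) (Fin 2) ℤ} (k : fibreGroup A) : Plane :=
  Function.surjInv proj_surjective (k : Torus)

theorem proj_fibreLift {A : Matrix (Fin 2) (Fin 2) ℤ} (k : fibreGroup A) :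
    proj (fibreLift k) = k :=
  Function.surjInv_eq _ _

/-- The lifts of the preimages of `proj p` under `shearEndo E₁ t r`, one for each element of
`fibreGroup E₁`. -/
def branch {E₁ : Matrix (Fin 2) (Fin 2) ℤ} (t r : ℝ) (k : fibreGroup E₁) (p : Plane) : Plane :=
  shearLift (-t) r (planeMap (toReal E₁)⁻¹ p + fibreLift k)

theorem proj_branch {E₁ : Matrix (Fin 2) (Fin 2) ℤ} (t r : ℝ) (k : fibreGroup E₁) (p : Plane) :
    proj (branch t r k p) = shear (-t) r (proj (planeMap (toReal E₁)⁻¹ p) + k) := by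
  rw [branch, ← shear_proj, proj_add, proj_fibreLift]

theorem shearEndo_branch {E₁ : Matrix (Fin 2) (Fin 2) ℤ} (h : E₁.det ≠ 0) (t r : ℝ)
    (k : fibreGroup E₁) (p : Plane) : shearEndo E₁ t r (proj (branch t r k p)) = proj p := by
  rw [proj_branch, shearEndo, shear_shear_neg, linearEndo_add, linearEndo_proj,
    planeMap_toReal_inv h, mem_fibreGroup.1 k.2, add_zero]

theorem proj_branch_injective {E₁ : Matrix (Fin 2) (Fin 2) ℤ} (t r : ℝ) (p : Plane) :
    Function.Injective fun k : fibreGroup E₁ => proj (branch t r k p) := by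
  intro k l hkl
  simp only [proj_branch] at hkl
  have := congrArg (shear t r) hkl
  rw [shear_shear_neg, shear_shear_neg] at this
  exact Subtype.ext (add_left_cancel this)

theorem shearEndo_preimage {E₁ : Matrix (Fin 2) (Fin 2) ℤ} (h : E₁.det ≠ 0) (t r : ℝ)
    (p : Plane) : shearEndo E₁ t r ⁻¹' {proj p} =
      range fun k : fibreGroup E₁ => proj (branch t r k p) := by
  ext y
  constructor
  · intro hy
    have hy' : linearEndo E₁ (shear t r y) = proj p := hy
    have hk : shear t r y - proj (planeMap (toReal E₁)⁻¹ p) ∈ fibreGroup E₁ := by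
      rw [AddMonoidHom.mem_ker, map_sub, sub_eq_zero]
      change linearEndo E₁ _ = linearEndo E₁ _
      rw [hy', linearEndo_proj, planeMap_toReal_inv h]
    refine ⟨⟨_, hk⟩, ?_⟩
    simp only [proj_branch]
    rw [add_sub_cancel, shear_neg_shear]
  · rintro ⟨k, rfl⟩
    exact shearEndo_branch h t r k p

/-- The conjugate of `shearEndo E₁ t r` by `basisChange n`; here the shear is in the direction
of the second column of `basisChange n`. -/
def conjEndo (E₁ : Matrix (Fin 2) (Fin 2) ℤ) (n : ℤ) (t r : ℝ) (x : Torus) : Torus :=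
  linearEndo (basisChange n) (shearEndo E₁ t r (linearEndo (basisChangeInv n) x))

/-- The lift of `conjEndo E₁ n t r` to the plane. -/
def conjLift (E₁ : Matrix (Fin 2) (Fin 2) ℤ) (n : ℤ) (t r : ℝ) (v : Plane) : Plane :=
  planeMap (toReal (basisChange n * E₁)) (shearLift t r (planeMap (toReal (basisChangeInv n)) v))

theorem linearEndo_basisChange_inv (n : ℤ) (x : Torus) :
    linearEndo (basisChange n) (linearEndo (basisChangeInv n) x) = x := by
  rw [← linearEndo_mul, basisChange_mul_inv, linearEndo_one]

theorem linearEndo_inv_basisChange (n : ℤ) (x : Torus) :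
    linearEndo (basisChangeInv n) (linearEndo (basisChange n) x) = x := by
  rw [← linearEndo_mul, basisChange_inv_mul, linearEndo_one]

theorem toReal_mul (A B : Matrix (Fin 2) (Fin 2) ℤ) : toReal (A * B) = toReal A * toReal B :=
  Matrix.map_mul

theorem toReal_one : toReal 1 = 1 := by
  simp [toReal]

theorem planeMap_basisChange_inv (n : ℤ) (v : Plane) :
    planeMap (toReal (basisChange n)) (planeMap (toReal (basisChangeInv n)) v) = v := by
  rw [← ContinuousLinearMap.comp_apply, ← planeMap_mul, ← toReal_mul, basisChange_mul_inv,
    toReal_one, planeMap_one]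
  rfl

theorem planeMap_inv_basisChange (n : ℤ) (v : Plane) :
    planeMap (toReal (basisChangeInv n)) (planeMap (toReal (basisChange n)) v) = v := by
  rw [← ContinuousLinearMap.comp_apply, ← planeMap_mul, ← toReal_mul, basisChange_inv_mul,
    toReal_one, planeMap_one]
  rfl

theorem conjEndo_proj (E₁ : Matrix (Fin 2) (Fin 2) ℤ) (n : ℤ) (t r : ℝ) (v : Plane) :
    conjEndo E₁ n t r (proj v) = proj (conjLift E₁ n t r v) := by
  rw [conjEndo, shearEndo, linearEndo_proj, shear_proj, ← linearEndo_mul, linearEndo_proj, conjLift]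

theorem conjEndo_preimage {E₁ : Matrix (Fin 2) (Fin 2) ℤ} (h : E₁.det ≠ 0) (n : ℤ) (t r : ℝ)
    (p : Plane) : conjEndo E₁ n t r ⁻¹' {proj (planeMap (toReal (basisChange n)) p)} =
      range fun k : fibreGroup E₁ =>
        proj (planeMap (toReal (basisChange n)) (branch t r k p)) := by
  have h1 : ∀ y, conjEndo E₁ n t r y = proj (planeMap (toReal (basisChange n)) p) ↔
      shearEndo E₁ t r (linearEndo (basisChangeInv n) y) = proj p := by
    intro y
    rw [← linearEndo_proj, conjEndo]
    constructor
    · intro hy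
      have := congrArg (linearEndo (basisChangeInv n)) hy
      rwa [linearEndo_inv_basisChange, linearEndo_inv_basisChange] at this
    · intro hy
      rw [hy]
  have h2 := shearEndo_preimage h t r p
  ext y
  rw [mem_preimage, mem_singleton_iff, h1]
  have h3 : shearEndo E₁ t r (linearEndo (basisChangeInv n) y) = proj p ↔
      linearEndo (basisChangeInv n) y ∈ range fun k : fibreGroup E₁ => proj (branch t r k p) := by
    rw [← h2]; rfl
  rw [h3]
  constructor
  · rintro ⟨k, hk⟩
    refine ⟨k, ?_⟩
    simp only at hk ⊢
    rw [← linearEndo_proj, hk, linearEndo_basisChange_inv]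
  · rintro ⟨k, rfl⟩
    refine ⟨k, ?_⟩
    simp only
    rw [← linearEndo_proj, linearEndo_inv_basisChange]

theorem proj_basisChange_branch_injective {E₁ : Matrix (Fin 2) (Fin 2) ℤ} (n : ℤ) (t r : ℝ)
    (p : Plane) : Function.Injective fun k : fibreGroup E₁ =>
      proj (planeMap (toReal (basisChange n)) (branch t r k p)) := by
  intro k l hkl
  simp only [← linearEndo_proj] at hkl
  have := congrArg (linearEndo (basisChangeInv n)) hkl
  rw [linearEndo_inv_basisChange, linearEndo_inv_basisChange] at this
  exact proj_branch_injective t r p this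

/-- The inverse of the derivative of `shearEndo E₁ t r` at a point where the slope of the profile
is `σ`. -/
def invDeriv (E₁ : Matrix (Fin 2) (Fin 2) ℤ) (t σ : ℝ) : Plane →L[ℝ] Plane :=
  planeMap (shearMatrix (-t) σ * (toReal E₁)⁻¹)

theorem shearMatrix_neg_mul (t σ : ℝ) : shearMatrix (-t) σ * shearMatrix t σ = 1 := by
  ext i j; fin_cases i <;> fin_cases j <;> simp [shearMatrix]

theorem shearMatrix_mul_neg (t σ : ℝ) : shearMatrix t σ * shearMatrix (-t) σ = 1 := by
  ext i j; fin_cases i <;> fin_cases j <;> simp [shearMatrix]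

theorem det_basisChange (n : ℤ) : (basisChange n).det = 1 := by
  simp [basisChange, Matrix.det_fin_two]

theorem det_basisChangeInv (n : ℤ) : (basisChangeInv n).det = 1 := by
  simp [basisChangeInv, Matrix.det_fin_two]

theorem hasFDerivAt_conjLift (E₁ : Matrix (Fin 2) (Fin 2) ℤ) (n : ℤ) (t : ℝ) {r : ℝ}
    (hr0 : 0 < r) (hr1 : r < 1) (v : Plane) :
    HasFDerivAt (conjLift E₁ n t r) (planeMap (toReal (basisChange n * E₁) *
      shearMatrix t (profileSlope r (planeMap (toReal (basisChangeInv n)) v 0)) *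
      toReal (basisChangeInv n))) v := by
  rw [planeMap_mul, planeMap_mul]
  have h1 := (planeMap (toReal (basisChangeInv n))).hasFDerivAt (x := v)
  have h2 := hasFDerivAt_shearLift t hr0 hr1 (planeMap (toReal (basisChangeInv n)) v)
  exact ((planeMap (toReal (basisChange n * E₁))).hasFDerivAt.comp _ h2).comp v h1

/-- The recursion for the backward sums of `conjEndo`, in the coordinates given by
`basisChange n`. -/
theorem backwardSum_conjEndo_succ {E₁ : Matrix (Fin 2) (Fin 2) ℤ} (h : E₁.det ≠ 0)
    [Fintype (fibreGroup E₁)] (n : ℤ) (t : ℝ) {r : ℝ} (hr0 : 0 < r) (hr1 : r < 1) (m : ℕ)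
    (p u : Plane) :
    backwardSum (conjEndo E₁ n t r)^[m + 1] (proj (planeMap (toReal (basisChange n)) p))
        (planeMap (toReal (basisChange n)) u) =
      (|E₁.det| : ℝ)⁻¹ * ∑ k : fibreGroup E₁, backwardSum (conjEndo E₁ n t r)^[m]
        (proj (planeMap (toReal (basisChange n)) (branch t r k p)))
        (planeMap (toReal (basisChange n))
          (invDeriv E₁ t (profileSlope r (branch t r k p 0)) u)) := by
  have hD := hasFDerivAt_conjLift E₁ n t hr0 hr1
  set A : Plane → Plane →L[ℝ] Plane := fun v => planeMap (toReal (basisChange n) *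
    (shearMatrix (-t) (profileSlope r (planeMap (toReal (basisChangeInv n)) v 0)) *
      (toReal E₁)⁻¹) * toReal (basisChangeInv n)) with hA
  have hQ : toReal (basisChange n) * toReal (basisChangeInv n) = 1 := by
    rw [← toReal_mul, basisChange_mul_inv, toReal_one]
  have hQ' : toReal (basisChangeInv n) * toReal (basisChange n) = 1 := by
    rw [← toReal_mul, basisChange_inv_mul, toReal_one]
  have key : ∀ k : fibreGroup E₁, A (planeMap (toReal (basisChange n)) (branch t r k p))
      (planeMap (toReal (basisChange n)) u) = planeMap (toReal (basisChange n))
        (invDeriv E₁ t (profileSlope r (branch t r k p 0)) u) := by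
    intro k
    simp only [hA, invDeriv]
    rw [planeMap_inv_basisChange, ← ContinuousLinearMap.comp_apply,
      ← ContinuousLinearMap.comp_apply, ← planeMap_mul, ← planeMap_mul, mul_assoc _ _
      (toReal (basisChange n)), hQ', mul_one]
  simp_rw [← key]
  refine backwardSum_succ (conjEndo_proj E₁ n t r) (fun v => (hD v).differentiableAt)
    (A := A) ?_ ?_ ?_ ?_ (conjEndo_preimage h n t r p)
    (proj_basisChange_branch_injective n t r p) m _
  · intro v
    rw [(hD v).fderiv, hA, ← planeMap_mul, ← planeMap_one]
    congr 1
    generalize profileSlope r (planeMap (toReal (basisChangeInv n)) v 0) = σ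
    calc toReal (basisChange n * E₁) * shearMatrix t σ * toReal (basisChangeInv n) *
          (toReal (basisChange n) * (shearMatrix (-t) σ * (toReal E₁)⁻¹) *
            toReal (basisChangeInv n))
        = toReal (basisChange n) * (toReal E₁ * (shearMatrix t σ * (toReal (basisChangeInv n) *
          toReal (basisChange n)) * shearMatrix (-t) σ) * (toReal E₁)⁻¹) *
            toReal (basisChangeInv n) := by rw [toReal_mul]; simp only [mul_assoc]
      _ = 1 := by
        rw [hQ', mul_one, shearMatrix_mul_neg, mul_one, toReal_mul_inv h, mul_one, hQ]
  · intro v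
    rw [(hD v).fderiv, hA, ← planeMap_mul, ← planeMap_one]
    congr 1
    generalize profileSlope r (planeMap (toReal (basisChangeInv n)) v 0) = σ
    calc toReal (basisChange n) * (shearMatrix (-t) σ * (toReal E₁)⁻¹) *
          toReal (basisChangeInv n) *
          (toReal (basisChange n * E₁) * shearMatrix t σ * toReal (basisChangeInv n))
        = toReal (basisChange n) * (shearMatrix (-t) σ * ((toReal E₁)⁻¹ *
          ((toReal (basisChangeInv n) * toReal (basisChange n)) * toReal E₁)) * shearMatrix t σ) *
            toReal (basisChangeInv n) := by rw [toReal_mul]; simp only [mul_assoc]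
      _ = 1 := by
        rw [hQ', one_mul, inv_mul_toReal h, mul_one, shearMatrix_neg_mul, mul_one, hQ]
  · intro v
    rw [(hD v).fderiv, det_planeMap, Matrix.det_mul, Matrix.det_mul, toReal_det, toReal_det,
      Matrix.det_mul, det_basisChange, det_basisChangeInv]
    simp [shearMatrix, Matrix.det_fin_two]
  · intro x
    obtain ⟨v, rfl⟩ := proj_surjective x
    rw [← planeMap_basisChange_inv n v, conjEndo_preimage h]
    exact finite_range _

/-! ### Expansion in one backward step -/

/-- The sum norm of the plane. -/
def sumNorm (u : Plane) : ℝ := |u 0| + |u 1|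

theorem sumNorm_nonneg (u : Plane) : 0 ≤ sumNorm u := by
  unfold sumNorm; positivity

theorem sumNorm_pos {u : Plane} (hu : u ≠ 0) : 0 < sumNorm u := by
  rcases (sumNorm_nonneg u).lt_or_eq with h | h
  · exact h
  · exfalso
    apply hu
    unfold sumNorm at h
    have h0 := abs_nonneg (u 0)
    have h1 := abs_nonneg (u 1)
    apply plane_ext
    · exact abs_eq_zero.1 (by linarith)
    · exact abs_eq_zero.1 (by linarith)

theorem ne_zero_of_sumNorm_pos {u : Plane} (hu : 0 < sumNorm u) : u ≠ 0 := by
  rintro rfl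
  simp [sumNorm] at hu

theorem norm_le_sumNorm (u : Plane) : ‖u‖ ≤ sumNorm u := by
  rw [EuclideanSpace.norm_eq, Fin.sum_univ_two, sumNorm, Real.norm_eq_abs, Real.norm_eq_abs]
  apply Real.sqrt_le_iff.2 ⟨by positivity, ?_⟩
  nlinarith [mul_nonneg (abs_nonneg (u 0)) (abs_nonneg (u 1))]

theorem sumNorm_le_norm (u : Plane) : sumNorm u ≤ 2 * ‖u‖ := by
  have h0 := PiLp.norm_apply_le u 0
  have h1 := PiLp.norm_apply_le u 1
  rw [Real.norm_eq_abs] at h0 h1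
  unfold sumNorm
  linarith

theorem exists_sumNorm_planeMap_le (N : Matrix (Fin 2) (Fin 2) ℝ) :
    ∃ C : ℝ, 0 < C ∧ ∀ u, sumNorm (planeMap N u) ≤ C * sumNorm u := by
  refine ⟨2 * ‖planeMap N‖ + 1, by positivity, fun u => ?_⟩
  have h1 := sumNorm_le_norm (planeMap N u)
  have h2 := (planeMap N).le_opNorm u
  have h3 : ‖planeMap N‖ * ‖u‖ ≤ ‖planeMap N‖ * sumNorm u :=
    mul_le_mul_of_nonneg_left (norm_le_sumNorm u) (norm_nonneg _)
  have := sumNorm_nonneg u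
  linarith

/-- The vectors `u` for which `M u` is transverse to the direction of the shear, in a quantitative
sense. The constant is small enough for all almost vertical vectors `u` to qualify. -/
def Transverse (M : Matrix (Fin 2) (Fin 2) ℝ) (u : Plane) : Prop :=
  |M 0 1| / 4 * sumNorm u ≤ |planeMap M u 0|

/-- Almost vertical vectors are transverse, when `M` does not preserve the vertical direction. -/
theorem transverse_of_almost_vertical {M : Matrix (Fin 2) (Fin 2) ℝ} {ρ : ℝ} {u : Plane}
    (hρ1 : ρ ≤ 1) (hρ2 : ρ * |M 0 0| ≤ |M 0 1| / 2) (hu : |u 0| ≤ ρ * |u 1|) :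
    Transverse M u := by
  unfold Transverse sumNorm
  rw [planeMap_apply]
  have h1 : |M 0 1| * |u 1| - |M 0 0| * |u 0| ≤ |M 0 0 * u 0 + M 0 1 * u 1| := by
    rw [← abs_mul, ← abs_mul]
    have := abs_sub_abs_le_abs_sub (M 0 1 * u 1) (-(M 0 0 * u 0))
    rw [abs_neg, sub_neg_eq_add, add_comm (M 0 1 * u 1)] at this
    exact this
  have h2 : |M 0 0| * |u 0| ≤ |M 0 1| / 2 * |u 1| := by
    calc |M 0 0| * |u 0| ≤ |M 0 0| * (ρ * |u 1|) := by gcongr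
      _ = ρ * |M 0 0| * |u 1| := by ring
      _ ≤ _ := by gcongr
  have h3 : |u 0| ≤ |u 1| := hu.trans (by nlinarith [abs_nonneg (u 1)])
  have h4 : |M 0 1| / 4 * |u 0| ≤ |M 0 1| / 4 * |u 1| := by gcongr
  linarith

theorem invDeriv_apply_zero (E₁ : Matrix (Fin 2) (Fin 2) ℤ) (t σ : ℝ) (u : Plane) :
    invDeriv E₁ t σ u 0 = planeMap (toReal E₁)⁻¹ u 0 := by
  rw [invDeriv, planeMap_mul, ContinuousLinearMap.comp_apply, planeMap_apply (shearMatrix _ _)]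
  simp [shearMatrix]

theorem invDeriv_apply_one (E₁ : Matrix (Fin 2) (Fin 2) ℤ) (t σ : ℝ) (u : Plane) :
    invDeriv E₁ t σ u 1 =
      planeMap (toReal E₁)⁻¹ u 1 - t * σ * planeMap (toReal E₁)⁻¹ u 0 := by
  rw [invDeriv, planeMap_mul, ContinuousLinearMap.comp_apply, planeMap_apply (shearMatrix _ _)]
  simp [shearMatrix]
  ring

/-- The effect of the inverse derivative on a vector `u`, where `w = E₁⁻¹ u`: at worst it contracts
by a factor of order `t`; it expands transverse vectors by a factor of order `t`, unless the slope
is small; and if the slope has the right sign and is not small, it makes `u` transverse and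
contracts it by at most a bounded factor. -/
theorem exists_one_step {E₁ : Matrix (Fin 2) (Fin 2) ℤ} (h : E₁.det ≠ 0)
    (h01 : (toReal E₁)⁻¹ 0 1 ≠ 0) :
    ∃ C T : ℝ, 1 ≤ T ∧ ∀ t, T ≤ t → ∀ σ : ℝ, |σ| ≤ 1 → ∀ u : Plane, u ≠ 0 →
      invDeriv E₁ t σ u ≠ 0 ∧
      Real.log (sumNorm u) - Real.log t - C ≤ Real.log (sumNorm (invDeriv E₁ t σ u)) ∧
      (1 / 2 ≤ |σ| → Transverse (toReal E₁)⁻¹ u →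
        Transverse (toReal E₁)⁻¹ (invDeriv E₁ t σ u) ∧
        Real.log (sumNorm u) + Real.log t - C ≤ Real.log (sumNorm (invDeriv E₁ t σ u))) ∧
      (1 / 2 ≤ |σ| →
        σ * (planeMap (toReal E₁)⁻¹ u 0 * planeMap (toReal E₁)⁻¹ u 1) ≤ 0 →
        Transverse (toReal E₁)⁻¹ (invDeriv E₁ t σ u) ∧
        Real.log (sumNorm u) - C ≤ Real.log (sumNorm (invDeriv E₁ t σ u))) := by
  set M := (toReal E₁)⁻¹ with hM
  obtain ⟨C₀, hC₀, hup⟩ := exists_sumNorm_planeMap_le M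
  obtain ⟨C₁, hC₁, hlow'⟩ := exists_sumNorm_planeMap_le (toReal E₁)
  have hlow : ∀ u, sumNorm u ≤ C₁ * sumNorm (planeMap M u) := fun u => by
    have := hlow' (planeMap M u)
    rwa [planeMap_toReal_inv h] at this
  have hμ : 0 < |M 0 1| := abs_pos.2 h01
  set κ := |M 0 1| / 4 with hκ
  have hκ0 : 0 < κ := by positivity
  -- `ρ` bounds the ratio of the coordinates of an almost vertical vector
  obtain ⟨ρ, hρ0, hρ1, hρ2⟩ : ∃ ρ : ℝ, 0 < ρ ∧ ρ ≤ 1 ∧ ρ * |M 0 0| ≤ |M 0 1| / 2 := by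
    refine ⟨min 1 (|M 0 1| / 2 / (|M 0 0| + 1)), by positivity, min_le_left _ _, ?_⟩
    calc min 1 (|M 0 1| / 2 / (|M 0 0| + 1)) * |M 0 0|
        ≤ (|M 0 1| / 2 / (|M 0 0| + 1)) * (|M 0 0| + 1) := by
          gcongr
          · exact min_le_right _ _
          · linarith
      _ = |M 0 1| / 2 := by field_simp
  refine ⟨max (Real.log (2 * C₁)) (Real.log (4 / κ)),
    max 1 (max (2 / ρ) (max (4 * C₀ / κ) (4 * C₀ / (κ * ρ)))), le_max_left _ _, ?_⟩
  intro t ht σ hσ u hu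
  simp only [max_le_iff] at ht
  obtain ⟨ht1, ht2, ht3, ht4⟩ := ht
  have ht0 : 0 < t := by linarith
  have hN := sumNorm_pos hu
  have hup := hup u
  have hlow := hlow u
  set u' := invDeriv E₁ t σ u with hu'
  have e0 : u' 0 = planeMap M u 0 := invDeriv_apply_zero E₁ t σ u
  have e1 : u' 1 = planeMap M u 1 - t * σ * planeMap M u 0 := invDeriv_apply_one E₁ t σ u
  have htr : Transverse M u ↔ κ * sumNorm u ≤ |planeMap M u 0| := Iff.rfl
  rw [htr]
  have hsum : sumNorm (planeMap M u) = |planeMap M u 0| + |planeMap M u 1| := rfl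
  rw [hsum] at hup hlow
  set a := planeMap M u 0
  set b := planeMap M u 1
  have hsum' : sumNorm u' = |a| + |u' 1| := by rw [sumNorm, e0]
  have ha := abs_nonneg a
  have hb := abs_nonneg b
  have hu1 := abs_nonneg (u' 1)
  have hσ0 := abs_nonneg σ
  have htσ : |t * σ * a| = t * |σ| * |a| := by rw [abs_mul, abs_mul, abs_of_pos ht0]
  have g1 : |b| ≤ |u' 1| + t * |σ| * |a| := by
    rw [← htσ]
    calc |b| = |u' 1 + t * σ * a| := by rw [e1]; ring_nf
      _ ≤ _ := abs_add_le _ _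
  have g2 : t * |σ| * |a| ≤ |u' 1| + |b| := by
    rw [← htσ]
    calc |t * σ * a| = |b - u' 1| := by rw [e1]; ring_nf
      _ ≤ _ := by rw [add_comm]; exact abs_sub _ _
  have hlog : ∀ c : ℝ, 0 < c → ∀ x : ℝ, 0 < x → c * sumNorm u ≤ x →
      Real.log (sumNorm u) + Real.log c ≤ Real.log x := by
    intro c hc x hx hcx
    rw [← Real.log_mul hN.ne' hc.ne', mul_comm]
    exact Real.log_le_log (by positivity) hcx
  have s1 : sumNorm u ≤ 2 * C₁ * t * sumNorm u' := by
    have h1 : t * |σ| * |a| ≤ t * |a| := by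
      calc t * |σ| * |a| ≤ t * 1 * |a| := by gcongr
        _ = t * |a| := by ring
    have h2 : |a| ≤ t * |a| := le_mul_of_one_le_left ha ht1
    have h3 : |u' 1| ≤ t * |u' 1| := le_mul_of_one_le_left hu1 ht1
    have h4 : |a| + |b| ≤ 2 * t * sumNorm u' := by rw [hsum', mul_add]; linarith
    calc sumNorm u ≤ C₁ * (|a| + |b|) := hlow
      _ ≤ C₁ * (2 * t * sumNorm u') := by gcongr
      _ = _ := by ring
  have hN' : 0 < sumNorm u' := by
    by_contra hcon
    have : sumNorm u' = 0 := le_antisymm (not_lt.1 hcon) (sumNorm_nonneg _)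
    rw [this] at s1
    linarith
  refine ⟨ne_zero_of_sumNorm_pos hN', ?_, ?_, ?_⟩
  · have h1 := hlog (1 / (2 * C₁ * t)) (by positivity) _ hN' (by
      rw [div_mul_eq_mul_div, one_mul, div_le_iff₀ (by positivity)]
      linarith)
    rw [one_div, Real.log_inv, Real.log_mul (by positivity) ht0.ne'] at h1
    have := le_max_left (Real.log (2 * C₁)) (Real.log (4 / κ))
    linarith
  · intro hσ2 hT
    have h1 : t / 2 * |a| ≤ t * |σ| * |a| := by
      have : t / 2 ≤ t * |σ| := by linarith [mul_le_mul_of_nonneg_left hσ2 ht0.le]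
      gcongr
    have h2 : t / 2 * (κ * sumNorm u) ≤ t / 2 * |a| := by gcongr
    have h3 : C₀ * sumNorm u ≤ t / 4 * (κ * sumNorm u) := by
      rw [div_le_iff₀ hκ0] at ht3
      calc C₀ * sumNorm u ≤ (t * κ / 4) * sumNorm u := by gcongr; linarith
        _ = _ := by ring
    have h4 : t / 4 * (κ * sumNorm u) ≤ |u' 1| := by linarith
    have h5 : |a| ≤ ρ * |u' 1| := by
      rw [div_le_iff₀ (by positivity)] at ht4
      calc |a| ≤ C₀ * sumNorm u := by linarith
        _ ≤ (t * (κ * ρ) / 4) * sumNorm u := by gcongr; linarith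
        _ = ρ * (t / 4 * (κ * sumNorm u)) := by ring
        _ ≤ _ := by gcongr
    refine ⟨transverse_of_almost_vertical hρ1 hρ2 (by rw [e0]; exact h5), ?_⟩
    have h6 := hlog (t / (4 / κ)) (by positivity) _ hN' (by
      rw [hsum']
      calc t / (4 / κ) * sumNorm u = t / 4 * (κ * sumNorm u) := by field_simp
        _ ≤ _ := by linarith)
    rw [Real.log_div ht0.ne' (by positivity)] at h6
    have := le_max_right (Real.log (2 * C₁)) (Real.log (4 / κ))
    linarith
  · intro hσ2 hab
    -- the two summands of the second coordinate have the same sign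
    have h1 : |u' 1| = |b| + t * |σ| * |a| := by
      rw [e1, ← htσ, sub_eq_add_neg, ← abs_neg (t * σ * a), abs_add_eq_add_abs_iff]
      have h2 : 0 ≤ b * (-(t * σ * a)) := by
        have := mul_nonneg ht0.le (neg_nonneg.2 hab)
        linarith
      rcases mul_nonneg_iff.1 h2 with h3 | h3
      · exact Or.inl h3
      · exact Or.inr h3
    have h2 : t / 2 * |a| ≤ t * |σ| * |a| := by
      have : t / 2 ≤ t * |σ| := by linarith [mul_le_mul_of_nonneg_left hσ2 ht0.le]
      gcongr
    have h3 : |a| ≤ ρ * |u' 1| := by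
      rw [div_le_iff₀ hρ0] at ht2
      calc |a| ≤ (t * ρ / 2) * |a| := le_mul_of_one_le_left ha (by linarith)
        _ = ρ * (t / 2 * |a|) := by ring
        _ ≤ _ := by gcongr; linarith
    refine ⟨transverse_of_almost_vertical hρ1 hρ2 (by rw [e0]; exact h3), ?_⟩
    have h4 := hlog (1 / (2 * C₁)) (by positivity) _ hN' (by
      rw [div_mul_eq_mul_div, one_mul, div_le_iff₀ (by positivity), hsum']
      have : |a| + |b| ≤ |a| + |u' 1| := by
        have : 0 ≤ t * |σ| * |a| := by positivity
        linarith
      calc sumNorm u ≤ C₁ * (|a| + |b|) := hlow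
        _ ≤ C₁ * (|a| + |u' 1|) := by gcongr
        _ ≤ _ := by
          have : 0 ≤ C₁ * (|a| + |u' 1|) := by positivity
          linarith)
    rw [one_div, Real.log_inv] at h4
    have := le_max_left (Real.log (2 * C₁)) (Real.log (4 / κ))
    linarith

open Classical in
/-- The logarithm of the size of a vector, with a bonus for transverse vectors. -/
def potential (E₁ : Matrix (Fin 2) (Fin 2) ℤ) (t : ℝ) (u : Plane) : ℝ :=
  Real.log (sumNorm u) + if Transverse (toReal E₁)⁻¹ u then |(E₁.det : ℝ)| * Real.log t else 0

theorem card_fibreGroup' {E₁ : Matrix (Fin 2) (Fin 2) ℤ} (h : E₁.det ≠ 0)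
    [Fintype (fibreGroup E₁)] : (Fintype.card (fibreGroup E₁) : ℝ) = |(E₁.det : ℝ)| := by
  rw [← Nat.card_eq_fintype_card, card_fibreGroup h, Nat.cast_natAbs, Int.cast_abs]

/-- In one backward step the average of the potential increases by an amount of order `log t`,
unless the slope is small at a preimage; in any case it decreases by at most an amount of order
`log t`. A vector that is not transverse loses at most `log t` at all but one of the `d`
preimages, and gains the bonus `d log t` at the remaining one. -/
theorem exists_potential_step {E₁ : Matrix (Fin 2) (Fin 2) ℤ} (h : E₁.det ≠ 0)
    (h01 : (toReal E₁)⁻¹ 0 1 ≠ 0) [Fintype (fibreGroup E₁)] :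
    ∃ C T : ℝ, 1 ≤ T ∧ ∀ t, T ≤ t → ∀ σ : fibreGroup E₁ → ℝ, (∀ k, |σ k| ≤ 1) →
      ∀ u : Plane, u ≠ 0 →
      (∀ k, invDeriv E₁ t (σ k) u ≠ 0) ∧
      potential E₁ t u - (|(E₁.det : ℝ)| + 1) * Real.log t - C ≤
        |(E₁.det : ℝ)|⁻¹ * ∑ k, potential E₁ t (invDeriv E₁ t (σ k) u) ∧
      ((∀ k, 1 / 2 ≤ |σ k|) → (∃ k, 0 ≤ σ k) → (∃ k, σ k ≤ 0) →
        potential E₁ t u + |(E₁.det : ℝ)|⁻¹ * Real.log t - C ≤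
          |(E₁.det : ℝ)|⁻¹ * ∑ k, potential E₁ t (invDeriv E₁ t (σ k) u)) := by
  obtain ⟨C, T, hT, hstep⟩ := exists_one_step h h01
  refine ⟨C, T, hT, fun t ht σ hσ u hu => ?_⟩
  have hstep := fun k => hstep t ht (σ k) (hσ k) u hu
  have hcard := card_fibreGroup' h
  set d := |(E₁.det : ℝ)| with hd
  have hd1 : 1 ≤ d := by
    rw [← hcard]
    exact_mod_cast Fintype.card_pos
  have hd0 : 0 < d := by linarith
  have hL : 0 ≤ Real.log t := Real.log_nonneg (by linarith)
  have havg : ∀ x : ℝ, ∀ g : fibreGroup E₁ → ℝ, (d * x ≤ ∑ k, g k) → x ≤ d⁻¹ * ∑ k, g k := by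
    intro x g hx
    rw [inv_mul_eq_div, le_div_iff₀ hd0]
    linarith
  have hconst : ∀ x : ℝ, ∑ _k : fibreGroup E₁, x = d * x := by
    intro x
    rw [Finset.sum_const, nsmul_eq_mul, Finset.card_univ, hcard]
  have hpot : ∀ k, Real.log (sumNorm u) - Real.log t - C ≤
      potential E₁ t (invDeriv E₁ t (σ k) u) := by
    intro k
    have h1 := (hstep k).2.1
    unfold potential
    split_ifs
    · have : 0 ≤ d * Real.log t := by positivity
      linarith
    · linarith
  refine ⟨fun k => (hstep k).1, ?_, ?_⟩
  · apply havg
    rw [← hconst]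
    refine Finset.sum_le_sum fun k _ => ?_
    refine le_trans ?_ (hpot k)
    unfold potential
    rw [add_mul, one_mul]
    split_ifs
    · linarith
    · have : 0 ≤ d * Real.log t := by positivity
      linarith
  · intro hσ2 hpos hneg
    by_cases hu' : Transverse (toReal E₁)⁻¹ u
    · apply havg
      rw [← hconst]
      refine Finset.sum_le_sum fun k _ => ?_
      obtain ⟨h1, h2⟩ := (hstep k).2.2.1 (hσ2 k) hu'
      unfold potential
      rw [if_pos hu', if_pos h1]
      have : d⁻¹ * Real.log t ≤ 1 * Real.log t := by
        gcongr
        exact inv_le_one_of_one_le₀ hd1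
      linarith
    · obtain ⟨k₀, hk₀⟩ : ∃ k, σ k *
          (planeMap (toReal E₁)⁻¹ u 0 * planeMap (toReal E₁)⁻¹ u 1) ≤ 0 := by
        rcases le_total 0 (planeMap (toReal E₁)⁻¹ u 0 * planeMap (toReal E₁)⁻¹ u 1) with h1 | h1
        · obtain ⟨k, hk⟩ := hneg
          exact ⟨k, mul_nonpos_of_nonpos_of_nonneg hk h1⟩
        · obtain ⟨k, hk⟩ := hpos
          exact ⟨k, mul_nonpos_of_nonneg_of_nonpos hk h1⟩
      obtain ⟨h1, h2⟩ := (hstep k₀).2.2.2 (hσ2 k₀) hk₀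
      classical
      apply havg
      have hsum : ∑ k, (Real.log (sumNorm u) - Real.log t - C +
          if k = k₀ then (d + 1) * Real.log t else 0) ≤
          ∑ k, potential E₁ t (invDeriv E₁ t (σ k) u) := by
        refine Finset.sum_le_sum fun k _ => ?_
        split_ifs with hk
        · subst hk
          unfold potential
          rw [if_pos h1]
          linarith
        · linarith [hpot k]
      rw [Finset.sum_add_distrib, hconst, Finset.sum_ite_eq' Finset.univ k₀] at hsum
      simp only [Finset.mem_univ, if_true] at hsum
      refine le_trans (le_of_eq ?_) hsum
      unfold potential
      rw [if_neg hu']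
      field_simp
      ring

/-! ### Preimages on both sides of the fold -/

/-- If the fibres are not vertical, the sines of the first coordinates along a fibre add up to
zero, because this is a sum of values of a nontrivial character. -/
theorem sum_sin_fibre {E₁ : Matrix (Fin 2) (Fin 2) ℤ} [Fintype (fibreGroup E₁)]
    (hK : ∃ k : fibreGroup E₁, (k : Torus) 0 ≠ 0) (x : ℝ) :
    ∑ k : fibreGroup E₁, Real.sin (2 * Real.pi * (x + fibreLift k 0)) = 0 := by
  have hexp : ∀ (y : ℝ), (AddCircle.toCircle (y : UnitAddCircle) : ℂ) =
      Complex.exp (((2 * Real.pi * y : ℝ) : ℂ) * Complex.I) := by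
    intro y
    rw [AddCircle.toCircle_apply_mk, Circle.coe_exp]
    simp
  let ψ : fibreGroup E₁ → ℂ := fun k => (AddCircle.toCircle ((k : Torus) 0) : ℂ)
  have hψ : ∀ k l, ψ (k + l) = ψ k * ψ l := by
    intro k l
    simp [ψ, AddCircle.toCircle_add]
  have hz : ∑ k, ψ k = 0 := by
    obtain ⟨l, hl⟩ := hK
    have h1 : ψ l ≠ 1 := by
      intro h1
      apply hl
      apply AddCircle.injective_toCircle (T := (1 : ℝ)) one_ne_zero
      rw [AddCircle.toCircle_zero]
      exact Subtype.ext h1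
    have h2 : ψ l * ∑ k, ψ k = ∑ k, ψ k := by
      rw [Finset.mul_sum]
      simp_rw [← hψ]
      exact Equiv.sum_comp (Equiv.addLeft l) ψ
    have h3 : (ψ l - 1) * ∑ k, ψ k = 0 := by rw [sub_mul, h2]; ring
    exact (mul_eq_zero.1 h3).resolve_left (sub_ne_zero.2 h1)
  have h1 : ∀ k : fibreGroup E₁, Real.sin (2 * Real.pi * (x + fibreLift k 0)) =
      ((AddCircle.toCircle (x : UnitAddCircle) : ℂ) * ψ k).im := by
    intro k
    have h2 : ψ k = (AddCircle.toCircle ((fibreLift k 0 : ℝ) : UnitAddCircle) : ℂ) := by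
      have := congrFun (proj_fibreLift k) 0
      simp only [proj] at this
      simp only [ψ, this]
    rw [h2, ← Circle.coe_mul, ← AddCircle.toCircle_add, ← AddCircle.coe_add, hexp,
      Complex.exp_ofReal_mul_I_im]
  simp_rw [h1]
  rw [← Complex.im_sum, ← Finset.mul_sum, hz]
  simp

theorem branch_zero {E₁ : Matrix (Fin 2) (Fin 2) ℤ} (t r : ℝ) (k : fibreGroup E₁) (p : Plane) :
    branch t r k p 0 = planeMap (toReal E₁)⁻¹ p 0 + fibreLift k 0 := by
  rw [branch, shearLift_zero]; simp

theorem exists_branch_sin_nonneg {E₁ : Matrix (Fin 2) (Fin 2) ℤ} [Fintype (fibreGroup E₁)]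
    (hK : ∃ k : fibreGroup E₁, (k : Torus) 0 ≠ 0) (t r : ℝ) (p : Plane) :
    ∃ k : fibreGroup E₁, 0 ≤ Real.sin (2 * Real.pi * branch t r k p 0) := by
  by_contra! hcon
  have := sum_sin_fibre hK (planeMap (toReal E₁)⁻¹ p 0)
  simp_rw [← branch_zero t r] at this
  have h2 := Finset.sum_lt_sum_of_nonempty (Finset.univ_nonempty) fun k _ => hcon k
  rw [this] at h2
  simp at h2

theorem exists_branch_sin_nonpos {E₁ : Matrix (Fin 2) (Fin 2) ℤ} [Fintype (fibreGroup E₁)]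
    (hK : ∃ k : fibreGroup E₁, (k : Torus) 0 ≠ 0) (t r : ℝ) (p : Plane) :
    ∃ k : fibreGroup E₁, Real.sin (2 * Real.pi * branch t r k p 0) ≤ 0 := by
  by_contra! hcon
  have := sum_sin_fibre hK (planeMap (toReal E₁)⁻¹ p 0)
  simp_rw [← branch_zero t r] at this
  have h2 := Finset.sum_lt_sum_of_nonempty (Finset.univ_nonempty) fun k _ => hcon k
  rw [this] at h2
  simp at h2

/-! ### Averages over the preimages -/

theorem abs_det_pos {E₁ : Matrix (Fin 2) (Fin 2) ℤ} (h : E₁.det ≠ 0) : 0 < |(E₁.det : ℝ)| :=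
  abs_pos.2 (Int.cast_ne_zero.2 h)

/-- The average of a function over the preimages of a point under `shearEndo E₁ t r`. -/
def backAvg (E₁ : Matrix (Fin 2) (Fin 2) ℤ) [Fintype (fibreGroup E₁)] (t r : ℝ) (φ : Torus → ℝ)
    (y : Torus) : ℝ :=
  |(E₁.det : ℝ)|⁻¹ * ∑ k : fibreGroup E₁,
    φ (proj (branch t r k (Function.surjInv proj_surjective y)))

section backAvg

variable {E₁ : Matrix (Fin 2) (Fin 2) ℤ} [Fintype (fibreGroup E₁)] {t r : ℝ}

theorem backAvg_proj (h : E₁.det ≠ 0) (φ : Torus → ℝ) (p : Plane) :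
    backAvg E₁ t r φ (proj p) =
      |(E₁.det : ℝ)|⁻¹ * ∑ k : fibreGroup E₁, φ (proj (branch t r k p)) := by
  unfold backAvg
  congr 1
  set p' := Function.surjInv proj_surjective (proj p) with hp'
  have hpp : proj p' = proj p := Function.surjInv_eq _ _
  let l : fibreGroup E₁ :=
    ⟨proj (planeMap (toReal E₁)⁻¹ p') - proj (planeMap (toReal E₁)⁻¹ p), by
      rw [AddMonoidHom.mem_ker, map_sub, sub_eq_zero]
      change linearEndo E₁ _ = linearEndo E₁ _
      rw [linearEndo_proj, linearEndo_proj, planeMap_toReal_inv h, planeMap_toReal_inv h, hpp]⟩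
  rw [← Equiv.sum_comp (Equiv.addLeft l) fun k => φ (proj (branch t r k p))]
  refine Finset.sum_congr rfl fun k _ => ?_
  simp only [proj_branch, Equiv.coe_addLeft, AddSubgroup.coe_add, l]
  congr 2
  abel

theorem backAvg_mono (h : E₁.det ≠ 0) {φ ψ : Torus → ℝ} (hφ : φ ≤ ψ) :
    backAvg E₁ t r φ ≤ backAvg E₁ t r ψ := fun _ =>
  mul_le_mul_of_nonneg_left (Finset.sum_le_sum fun _ _ => hφ _)
    (inv_nonneg.2 (abs_det_pos h).le)

theorem backAvg_const (h : E₁.det ≠ 0) (c : ℝ) : backAvg E₁ t r (fun _ => c) = fun _ => c := by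
  funext y
  rw [backAvg, Finset.sum_const, nsmul_eq_mul, Finset.card_univ, card_fibreGroup' h,
    inv_mul_cancel_left₀ (abs_det_pos h).ne']

theorem backAvg_iterate_mono (h : E₁.det ≠ 0) (m : ℕ) {φ ψ : Torus → ℝ} (hφ : φ ≤ ψ) :
    (backAvg E₁ t r)^[m] φ ≤ (backAvg E₁ t r)^[m] ψ := by
  induction m with
  | zero => exact hφ
  | succ m ih =>
    rw [Function.iterate_succ_apply', Function.iterate_succ_apply']
    exact backAvg_mono h ih

theorem backAvg_iterate_const (h : E₁.det ≠ 0) (m : ℕ) (c : ℝ) :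
    (backAvg E₁ t r)^[m] (fun _ => c) = fun _ => c := by
  induction m with
  | zero => rfl
  | succ m ih => rw [Function.iterate_succ_apply', ih, backAvg_const h]

/-- A point is one of the `d` preimages of at most one point. -/
theorem backAvg_single_le (h : E₁.det ≠ 0) (z y : Torus) :
    backAvg E₁ t r (indicator {z} 1) y ≤
      |(E₁.det : ℝ)|⁻¹ * indicator {shearEndo E₁ t r z} 1 y := by
  obtain ⟨p, rfl⟩ := proj_surjective y
  rw [backAvg_proj h]
  refine mul_le_mul_of_nonneg_left ?_ (inv_nonneg.2 (abs_det_pos h).le)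
  classical
  by_cases hk : ∃ k : fibreGroup E₁, proj (branch t r k p) = z
  · obtain ⟨k, rfl⟩ := hk
    rw [shearEndo_branch h, indicator_of_mem (mem_singleton _), Pi.one_apply,
      Finset.sum_eq_single k]
    · simp
    · intro l _ hl
      exact indicator_of_notMem (s := {proj (branch t r k p)})
        (fun hh => hl (proj_branch_injective t r p hh)) (1 : Torus → ℝ)
    · simp
  · push Not at hk
    rw [Finset.sum_eq_zero fun k _ =>
      indicator_of_notMem (s := {z}) (hk k) (1 : Torus → ℝ)]
    exact indicator_nonneg (fun _ _ => zero_le_one) _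

theorem backAvg_iterate_le (h : E₁.det ≠ 0) (c : ℝ) (Z : Finset Torus) {φ : Torus → ℝ}
    (hφ : ∀ y, φ y ≤ c + ∑ z ∈ Z, indicator {z} 1 y) (m : ℕ) (y : Torus) :
    (backAvg E₁ t r)^[m] φ y ≤ c + ∑ z ∈ Z, |(E₁.det : ℝ)|⁻¹ ^ m *
      indicator {(shearEndo E₁ t r)^[m] z} 1 y := by
  have hd := inv_nonneg.2 (abs_det_pos h).le
  induction m generalizing y with
  | zero => simpa using hφ y
  | succ m ih =>
    rw [Function.iterate_succ_apply']
    refine (backAvg_mono h (ψ := fun y => c + ∑ z ∈ Z, |(E₁.det : ℝ)|⁻¹ ^ m *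
      indicator {(shearEndo E₁ t r)^[m] z} 1 y) ih y).trans ?_
    have hlin : backAvg E₁ t r (fun y => c + ∑ z ∈ Z, |(E₁.det : ℝ)|⁻¹ ^ m *
        indicator {(shearEndo E₁ t r)^[m] z} 1 y) y = c + ∑ z ∈ Z, |(E₁.det : ℝ)|⁻¹ ^ m *
          backAvg E₁ t r (indicator {(shearEndo E₁ t r)^[m] z} 1) y := by
      have hc := congrFun (backAvg_const (t := t) (r := r) h c) y
      unfold backAvg at hc ⊢
      rw [Finset.sum_add_distrib, mul_add, hc, Finset.sum_comm, Finset.mul_sum]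
      congr 1
      refine Finset.sum_congr rfl fun z _ => ?_
      rw [← Finset.mul_sum]
      ring
    rw [hlin]
    refine add_le_add le_rfl (Finset.sum_le_sum fun z _ => ?_)
    rw [pow_succ, mul_assoc, Function.iterate_succ_apply']
    exact mul_le_mul_of_nonneg_left (backAvg_single_le h _ _) (pow_nonneg hd m)

end backAvg

/-! ### The frequency of visits to the fold -/

/-- The neighbourhood of the fold lines of the shear in which the slope of the profile is not
controlled. For `r = 1` it consists of the lines where the triangle wave is not differentiable. -/
def foldSet (r : ℝ) : Set Torus := {y | (AddCircle.toCircle (y 0) : ℂ).im ^ 2 ≤ 1 - r ^ 2}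

theorem proj_mem_foldSet {r : ℝ} {p : Plane} :
    proj p ∈ foldSet r ↔ Real.sin (2 * Real.pi * p 0) ^ 2 ≤ 1 - r ^ 2 := by
  have hexp : (AddCircle.toCircle (proj p 0) : ℂ) =
      Complex.exp (((2 * Real.pi * p 0 : ℝ) : ℂ) * Complex.I) := by
    rw [proj, AddCircle.toCircle_apply_mk, Circle.coe_exp]
    simp
  rw [foldSet, mem_ofPred_eq, hexp, Complex.exp_ofReal_mul_I_im]

/-- The proportion of the preimages of a point under the `m`-th iterate that lie in the fold. -/
def foldFreq (E₁ : Matrix (Fin 2) (Fin 2) ℤ) [Fintype (fibreGroup E₁)] (t r : ℝ) (m : ℕ) :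
    Torus → ℝ :=
  (backAvg E₁ t r)^[m] ((foldSet r).indicator 1)

section foldFreq

variable {E₁ : Matrix (Fin 2) (Fin 2) ℤ} [Fintype (fibreGroup E₁)] {t r : ℝ}

theorem foldFreq_succ_proj (h : E₁.det ≠ 0) (m : ℕ) (p : Plane) :
    foldFreq E₁ t r (m + 1) (proj p) = |(E₁.det : ℝ)|⁻¹ * ∑ k : fibreGroup E₁,
      foldFreq E₁ t r m (proj (branch t r k p)) := by
  rw [foldFreq, Function.iterate_succ_apply', backAvg_proj h]
  rfl

theorem foldFreq_nonneg (h : E₁.det ≠ 0) (m : ℕ) (y : Torus) : 0 ≤ foldFreq E₁ t r m y := by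
  have := backAvg_iterate_mono (t := t) (r := r) h m (φ := fun _ => 0)
    (ψ := (foldSet r).indicator 1) (fun y => indicator_nonneg (fun _ _ => zero_le_one) y) y
  rwa [backAvg_iterate_const h] at this

theorem foldFreq_le_one (h : E₁.det ≠ 0) (m : ℕ) (y : Torus) : foldFreq E₁ t r m y ≤ 1 := by
  have := backAvg_iterate_mono (t := t) (r := r) h m (φ := (foldSet r).indicator 1)
    (ψ := fun _ => 1) (fun y => indicator_le_self' (fun _ _ => zero_le_one) y) y
  rwa [backAvg_iterate_const h] at this

theorem foldFreq_le_of_le (h : E₁.det ≠ 0) {m : ℕ} {c : ℝ} (hm : ∀ y, foldFreq E₁ t r m y ≤ c)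
    {l : ℕ} (hl : m ≤ l) (y : Torus) : foldFreq E₁ t r l y ≤ c := by
  obtain ⟨j, rfl⟩ := Nat.exists_eq_add_of_le' hl
  have := backAvg_iterate_mono (t := t) (r := r) h j (φ := foldFreq E₁ t r m)
    (ψ := fun _ => c) hm y
  rw [backAvg_iterate_const h] at this
  rwa [foldFreq, Function.iterate_add_apply]

end foldFreq

/-! ### Pulling back lines -/

/-- The slope of the preimage of a line: if `μ x + y` is constant in the coordinates `M p`, then
`pullSlope M μ * x + y` is constant in the coordinates `p`. -/
def pullSlope (M : Matrix (Fin 2) (Fin 2) ℝ) (μ : ℝ) : ℝ :=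
  (μ * M 0 0 + M 1 0) / (μ * M 0 1 + M 1 1)

/-- The preimage of a line under the affine map that agrees with a branch where the triangle wave
is `x ↦ ε x - n`. A pair `(a, c)` stands for the line `a x + y = c`. -/
def pullLine (M : Matrix (Fin 2) (Fin 2) ℝ) (t : ℝ) (κ : Plane) (ε : ℝ) (n : ℤ) (q : ℝ × ℝ) :
    ℝ × ℝ :=
  (pullSlope M (q.1 - t * ε),
    (q.2 - t * n - (q.1 - t * ε) * κ 0 - κ 1) / ((q.1 - t * ε) * M 0 1 + M 1 1))

theorem mem_pullLine {E₁ : Matrix (Fin 2) (Fin 2) ℤ} {t ε : ℝ} {n : ℤ} {k : fibreGroup E₁}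
    {p : Plane} {q : ℝ × ℝ} (hD : (q.1 - t * ε) * (toReal E₁)⁻¹ 0 1 + (toReal E₁)⁻¹ 1 1 ≠ 0)
    (hprof : profile 1 (branch t 1 k p 0) = ε * branch t 1 k p 0 - n)
    (hq : q.1 * branch t 1 k p 0 + branch t 1 k p 1 = q.2) :
    (pullLine (toReal E₁)⁻¹ t (fibreLift k) ε n q).1 * p 0 + p 1 =
      (pullLine (toReal E₁)⁻¹ t (fibreLift k) ε n q).2 := by
  have h1 : branch t 1 k p 1 = planeMap (toReal E₁)⁻¹ p 1 + fibreLift k 1 -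
      t * profile 1 (branch t 1 k p 0) := by
    rw [branch_zero, branch, shearLift_one]
    simp; ring
  rw [h1, hprof, branch_zero, planeMap_apply, planeMap_apply] at hq
  set M := (toReal E₁)⁻¹
  simp only [pullLine, pullSlope]
  rw [div_mul_eq_mul_div, div_add' _ _ _ hD]
  congr 1
  linear_combination hq

/-- For large `t`, pulling back preserves a cone of slopes, and the two branches of the triangle
wave lead to different slopes. -/
theorem exists_pullSlope {M : Matrix (Fin 2) (Fin 2) ℝ} (hM : M.det ≠ 0) (h01 : M 0 1 ≠ 0) :
    ∃ T : ℝ, ∀ t, T ≤ t → (∀ ε : ℝ, |ε| = 1 → ∀ a : ℝ, |a - M 0 0 / M 0 1| ≤ 1 →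
      (a - t * ε) * M 0 1 + M 1 1 ≠ 0 ∧ |pullSlope M (a - t * ε) - M 0 0 / M 0 1| ≤ 1) ∧
      ∀ a b : ℝ, |a - M 0 0 / M 0 1| ≤ 1 → |b - M 0 0 / M 0 1| ≤ 1 →
        pullSlope M (a - t * 1) ≠ pullSlope M (b - t * (-1)) := by
  set a₀ := M 0 0 / M 0 1 with ha₀
  have hμ : 0 < |M 0 1| := abs_pos.2 h01
  have hδ : 0 < |M.det| := abs_pos.2 hM
  set T := |a₀| + 2 + (|M 1 1| + |M.det| / |M 0 1|) / |M 0 1| with hT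
  have hT2 : 2 ≤ T := by
    have : 0 ≤ (|M 1 1| + |M.det| / |M 0 1|) / |M 0 1| := by positivity
    have := abs_nonneg a₀
    linarith
  have hdet : M.det = M 0 0 * M 1 1 - M 0 1 * M 1 0 := Matrix.det_fin_two M
  have key : ∀ t, T ≤ t → ∀ ε : ℝ, |ε| = 1 → ∀ a : ℝ, |a - a₀| ≤ 1 →
      |M.det| / |M 0 1| ≤ |(a - t * ε) * M 0 1 + M 1 1| := by
    intro t ht ε hε a ha
    have h1 : t - |a₀| - 1 ≤ |a - t * ε| := by
      have e1 : |t * ε| = t := by rw [abs_mul, hε, mul_one, abs_of_nonneg (by linarith)]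
      have e2 := abs_sub_abs_le_abs_sub (t * ε) a
      rw [e1, abs_sub_comm] at e2
      have e3 := abs_sub_abs_le_abs_sub a a₀
      linarith
    have h2 : (|M 1 1| + |M.det| / |M 0 1|) / |M 0 1| ≤ |a - t * ε| := by linarith
    rw [div_le_iff₀ hμ, ← abs_mul] at h2
    have h3 := abs_sub_abs_le_abs_sub ((a - t * ε) * M 0 1) (-M 1 1)
    rw [abs_neg, sub_neg_eq_add] at h3
    linarith
  have hne : ∀ t, T ≤ t → ∀ ε : ℝ, |ε| = 1 → ∀ a : ℝ, |a - a₀| ≤ 1 →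
      (a - t * ε) * M 0 1 + M 1 1 ≠ 0 := by
    intro t ht ε hε a ha
    exact abs_pos.1 ((div_pos hδ hμ).trans_le (key t ht ε hε a ha))
  refine ⟨T, fun t ht => ⟨fun ε hε a ha => ⟨hne t ht ε hε a ha, ?_⟩, fun a b ha hb heq => ?_⟩⟩
  · have h1 := key t ht ε hε a ha
    have h2 := hne t ht ε hε a ha
    have h3 : pullSlope M (a - t * ε) - a₀ =
        -M.det / (M 0 1 * ((a - t * ε) * M 0 1 + M 1 1)) := by
      rw [pullSlope, ha₀, hdet]
      field_simp
      ring
    rw [h3, abs_div, abs_neg, abs_mul, div_le_one (by positivity)]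
    rw [div_le_iff₀ hμ] at h1
    linarith
  · have h1 := hne t ht 1 (by simp) a ha
    have h2 := hne t ht (-1) (by simp) b hb
    rw [pullSlope, pullSlope, div_eq_div_iff h1 h2] at heq
    have h3 : (a - b - 2 * t) * M.det = 0 := by
      rw [hdet]; linear_combination heq
    have h4 := (mul_eq_zero.1 h3).resolve_right hM
    rw [abs_le] at ha hb
    linarith [ha.2, hb.1]

/-- Finitely many lines with finitely many slopes meet in finitely many points. -/
theorem finite_intersections {S : Set (ℝ × ℝ)} (hS : S.Finite) :
    {p : Plane | ∃ q ∈ S, ∃ q' ∈ S, q.1 ≠ q'.1 ∧ q.1 * p 0 + p 1 = q.2 ∧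
      q'.1 * p 0 + p 1 = q'.2}.Finite := by
  refine ((hS.prod hS).image fun w : (ℝ × ℝ) × (ℝ × ℝ) => (!₂[(w.1.2 - w.2.2) / (w.1.1 - w.2.1),
    w.1.2 - w.1.1 * ((w.1.2 - w.2.2) / (w.1.1 - w.2.1))] : Plane)).subset ?_
  rintro p ⟨q, hq, q', hq', hne, h1, h2⟩
  refine ⟨(q, q'), ⟨hq, hq'⟩, ?_⟩
  have hne' : q.1 - q'.1 ≠ 0 := sub_ne_zero.2 hne
  have h3 : (q.2 - q'.2) / (q.1 - q'.1) = p 0 := by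
    rw [div_eq_iff hne']; linear_combination h2 - h1
  apply plane_ext
  · simp [h3]
  · simp only [h3]
    simp; linear_combination -h1

theorem exists_branch_bound {E₁ : Matrix (Fin 2) (Fin 2) ℤ} [Fintype (fibreGroup E₁)] (t r R : ℝ) :
    ∃ R' : ℝ, ∀ (k : fibreGroup E₁) (p : Plane), ‖p‖ ≤ R → ‖branch t r k p‖ ≤ R' := by
  have hc : ∀ k : fibreGroup E₁, Continuous (branch t r k) := fun k => by
    have h1 := continuous_shearLift (-t)
    unfold branch
    exact h1.comp (continuous_const.prodMk
      ((planeMap (toReal E₁)⁻¹).continuous.add continuous_const))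
  have hb : ∀ k : fibreGroup E₁, ∃ C, ∀ p ∈ Metric.closedBall (0 : Plane) R,
      ‖branch t r k p‖ ≤ C := fun k =>
    (isCompact_closedBall (0 : Plane) R).exists_bound_of_continuousOn (hc k).continuousOn
  choose C hC using hb
  refine ⟨∑ k, |C k|, fun k p hp => ?_⟩
  calc ‖branch t r k p‖ ≤ C k := hC k p (by simpa using hp)
    _ ≤ |C k| := le_abs_self _
    _ ≤ ∑ k, |C k| := Finset.single_le_sum (f := fun k => |C k|) (fun _ _ => abs_nonneg _)
      (Finset.mem_univ k)

theorem abs_apply_le_norm (p : Plane) (i : Fin 2) : |p i| ≤ ‖p‖ := by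
  simpa using PiLp.norm_apply_le p i

/-! ### The fold is visited rarely -/

section

variable {E₁ : Matrix (Fin 2) (Fin 2) ℤ} [Fintype (fibreGroup E₁)]

/-- On a bounded set, the points that have a preimage on the fold lines lie on finitely many
parallel lines. -/
theorem exists_lines_foldFreq_one (h : E₁.det ≠ 0) (h01 : (toReal E₁)⁻¹ 0 1 ≠ 0) (t R : ℝ) :
    ∃ S : Set (ℝ × ℝ), S.Finite ∧ (∀ q ∈ S, q.1 = (toReal E₁)⁻¹ 0 0 / (toReal E₁)⁻¹ 0 1) ∧
      ∀ p : Plane, ‖p‖ ≤ R → foldFreq E₁ t 1 1 (proj p) ≠ 0 → ∃ q ∈ S, q.1 * p 0 + p 1 = q.2 := by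
  obtain ⟨R', hR'⟩ := exists_branch_bound (E₁ := E₁) t 1 R
  set M := (toReal E₁)⁻¹
  refine ⟨(fun w : fibreGroup E₁ × ℤ =>
    ((M 0 0 / M 0 1, ((w.2 : ℝ) / 2 - fibreLift w.1 0) / M 0 1) : ℝ × ℝ)) ''
      (univ ×ˢ Icc (-⌈2 * R'⌉) ⌈2 * R'⌉), ?_, ?_, ?_⟩
  · exact (finite_univ.prod (finite_Icc _ _)).image _
  · rintro _ ⟨w, _, rfl⟩; rfl
  · intro p hp hne
    rw [← Nat.zero_add 1, foldFreq_succ_proj h] at hne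
    obtain ⟨k, _, hk⟩ := Finset.exists_ne_zero_of_sum_ne_zero (right_ne_zero_of_mul hne)
    have hk' : proj (branch t 1 k p) ∈ foldSet 1 := by
      by_contra hcon
      exact hk (indicator_of_notMem hcon _)
    rw [proj_mem_foldSet, one_pow, sub_self] at hk'
    have hsin : Real.sin (2 * Real.pi * branch t 1 k p 0) = 0 :=
      pow_eq_zero_iff two_ne_zero |>.1 (le_antisymm hk' (sq_nonneg _))
    obtain ⟨n, hn⟩ := Real.sin_eq_zero_iff.1 hsin
    have hn' : (n : ℝ) = 2 * branch t 1 k p 0 := by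
      have := Real.pi_pos
      have h2 : Real.pi * ((n : ℝ) - 2 * branch t 1 k p 0) = 0 := by linear_combination hn
      exact sub_eq_zero.1 ((mul_eq_zero.1 h2).resolve_left this.ne')
    have hb := (abs_apply_le_norm (branch t 1 k p) 0).trans (hR' k p hp)
    rw [abs_le] at hb
    refine ⟨_, ⟨(k, n), ⟨mem_univ _, ?_⟩, rfl⟩, ?_⟩
    · have := Int.le_ceil (2 * R')
      constructor
      · have : (-⌈2 * R'⌉ : ℝ) ≤ n := by linarith
        exact_mod_cast this
      · have : (n : ℝ) ≤ ⌈2 * R'⌉ := by linarith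
        exact_mod_cast this
    · simp only
      rw [branch_zero, planeMap_apply] at hn'
      rw [hn']
      field_simp
      ring

/-- The points that have a descendant on the fold lines after `m + 1` backward steps lie on
finitely many lines, in a bounded set. Off finitely many points (where two of these lines cross, or
that have an exceptional preimage) at each step the preimages on one side of the fold do not
contribute, so that the frequency of visits decays exponentially. -/
theorem exists_lines_foldFreq (h : E₁.det ≠ 0) (h01 : (toReal E₁)⁻¹ 0 1 ≠ 0)
    (hK : ∃ k : fibreGroup E₁, (k : Torus) 0 ≠ 0) :
    ∃ T : ℝ, ∀ t, T ≤ t → ∀ (m : ℕ) (R : ℝ), ∃ S : Set (ℝ × ℝ), S.Finite ∧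
      (∀ q ∈ S, |q.1 - (toReal E₁)⁻¹ 0 0 / (toReal E₁)⁻¹ 0 1| ≤ 1) ∧
      ∃ Z : Set Torus, Z.Finite ∧ ∀ p : Plane, ‖p‖ ≤ R →
        (foldFreq E₁ t 1 (m + 1) (proj p) ≠ 0 → ∃ q ∈ S, q.1 * p 0 + p 1 = q.2) ∧
        (proj p ∉ Z → foldFreq E₁ t 1 (m + 1) (proj p) ≤ (1 - |(E₁.det : ℝ)|⁻¹) ^ m) := by
  have hdet : ((toReal E₁)⁻¹).det ≠ 0 := by
    rw [Matrix.det_nonsing_inv, toReal_det, Ring.inverse_eq_inv']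
    exact inv_ne_zero (Int.cast_ne_zero.2 h)
  obtain ⟨T, hT⟩ := exists_pullSlope hdet h01
  refine ⟨T, fun t ht m => ?_⟩
  obtain ⟨hcone, hslope⟩ := hT t ht
  induction m with
  | zero =>
    intro R
    obtain ⟨S, hS, hS1, hS2⟩ := exists_lines_foldFreq_one h h01 t R
    refine ⟨S, hS, fun q hq => by rw [hS1 q hq]; simp, ∅, finite_empty, fun p hp =>
      ⟨hS2 p hp, fun _ => ?_⟩⟩
    rw [pow_zero]
    exact foldFreq_le_one h _ _
  | succ m ih =>
    intro R
    obtain ⟨R', hR'⟩ := exists_branch_bound (E₁ := E₁) t 1 R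
    obtain ⟨S, hS, hS1, Z, hZ, hSZ⟩ := ih R'
    set S' : Set (ℝ × ℝ) :=
      (fun w : (ℝ × ℝ) × fibreGroup E₁ × ℝ × ℤ =>
        pullLine (toReal E₁)⁻¹ t (fibreLift w.2.1) w.2.2.1 w.2.2.2 w.1) ''
        (S ×ˢ univ ×ˢ {1, -1} ×ˢ Icc (-⌈R' + 1⌉) ⌈R' + 1⌉) with hS'def
    have hS' : S'.Finite := by
      refine Set.Finite.image _ (hS.prod (finite_univ.prod (Set.Finite.prod ?_ (finite_Icc _ _))))
      exact (finite_singleton _).insert _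
    have hn : ∀ (k : fibreGroup E₁) (p : Plane), ‖p‖ ≤ R → ∀ n : ℤ,
        |(n : ℝ)| ≤ |branch t 1 k p 0| + 1 → n ∈ Icc (-⌈R' + 1⌉) ⌈R' + 1⌉ := by
      intro k p hp n hn
      have h1 := (abs_apply_le_norm (branch t 1 k p) 0).trans (hR' k p hp)
      have h2 := Int.le_ceil (R' + 1)
      have h3 := abs_le.1 (hn.trans (add_le_add_left h1 1))
      constructor
      · have : (-⌈R' + 1⌉ : ℝ) ≤ n := by linarith
        exact_mod_cast this
      · have : (n : ℝ) ≤ ⌈R' + 1⌉ := by linarith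
        exact_mod_cast this
    -- a preimage on one of the lines in `S` puts `p` on one of the lines in `S'`, whose slope
    -- depends on the side of the fold
    have hpos : ∀ (k : fibreGroup E₁) (p : Plane), ‖p‖ ≤ R →
        0 ≤ Real.sin (2 * Real.pi * branch t 1 k p 0) →
        foldFreq E₁ t 1 (m + 1) (proj (branch t 1 k p)) ≠ 0 →
        ∃ q' ∈ S', q'.1 * p 0 + p 1 = q'.2 ∧ ∃ q ∈ S,
          q'.1 = pullSlope (toReal E₁)⁻¹ (q.1 - t * 1) := by
      intro k p hp hs hne
      obtain ⟨q, hq, hqp⟩ := (hSZ _ (hR' k p hp)).1 hne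
      obtain ⟨n, hn1, hn2⟩ := profile_one_of_sin_nonneg hs
      refine ⟨pullLine (toReal E₁)⁻¹ t (fibreLift k) 1 n q, ⟨(q, k, 1, n),
        ⟨hq, mem_univ _, by simp, hn k p hp n hn1⟩, rfl⟩, ?_, q, hq, rfl⟩
      exact mem_pullLine (hcone 1 (by simp) _ (hS1 q hq)).1 (by rw [hn2, one_mul]) hqp
    have hneg : ∀ (k : fibreGroup E₁) (p : Plane), ‖p‖ ≤ R →
        Real.sin (2 * Real.pi * branch t 1 k p 0) ≤ 0 →
        foldFreq E₁ t 1 (m + 1) (proj (branch t 1 k p)) ≠ 0 →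
        ∃ q' ∈ S', q'.1 * p 0 + p 1 = q'.2 ∧ ∃ q ∈ S,
          q'.1 = pullSlope (toReal E₁)⁻¹ (q.1 - t * (-1)) := by
      intro k p hp hs hne
      obtain ⟨q, hq, hqp⟩ := (hSZ _ (hR' k p hp)).1 hne
      obtain ⟨n, hn1, hn2⟩ := profile_one_of_sin_nonpos hs
      refine ⟨pullLine (toReal E₁)⁻¹ t (fibreLift k) (-1) n q, ⟨(q, k, -1, n),
        ⟨hq, mem_univ _, by simp, hn k p hp n hn1⟩, rfl⟩, ?_, q, hq, rfl⟩
      exact mem_pullLine (hcone (-1) (by simp) _ (hS1 q hq)).1 (by rw [hn2, neg_one_mul]) hqp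
    refine ⟨S', hS', ?_, shearEndo E₁ t 1 '' Z ∪ proj '' {p : Plane | ∃ q ∈ S', ∃ q' ∈ S',
      q.1 ≠ q'.1 ∧ q.1 * p 0 + p 1 = q.2 ∧ q'.1 * p 0 + p 1 = q'.2},
      (hZ.image _).union ((finite_intersections hS').image _), fun p hp => ⟨fun hne => ?_,
        fun hpZ => ?_⟩⟩
    · rintro _ ⟨⟨q, k, ε, n⟩, ⟨hq, -, hε, -⟩, rfl⟩
      refine (hcone ε ?_ _ (hS1 q hq)).2
      have hε' : ε = 1 ∨ ε = -1 := hε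
      rcases hε' with rfl | rfl <;> simp
    · rw [foldFreq_succ_proj h] at hne
      obtain ⟨k, _, hk⟩ := Finset.exists_ne_zero_of_sum_ne_zero (right_ne_zero_of_mul hne)
      rcases le_total 0 (Real.sin (2 * Real.pi * branch t 1 k p 0)) with hs | hs
      · obtain ⟨q, hq, hqp, -⟩ := hpos k p hp hs hk
        exact ⟨q, hq, hqp⟩
      · obtain ⟨q, hq, hqp, -⟩ := hneg k p hp hs hk
        exact ⟨q, hq, hqp⟩
    · have hchild : ∀ k : fibreGroup E₁, foldFreq E₁ t 1 (m + 1) (proj (branch t 1 k p)) ≤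
          (1 - |(E₁.det : ℝ)|⁻¹) ^ m := by
        intro k
        refine (hSZ _ (hR' k p hp)).2 fun hmem => hpZ (Or.inl ⟨_, hmem, ?_⟩)
        exact shearEndo_branch h t 1 k p
      obtain ⟨k₀, hk₀⟩ : ∃ k : fibreGroup E₁,
          foldFreq E₁ t 1 (m + 1) (proj (branch t 1 k p)) = 0 := by
        by_contra! hcon
        obtain ⟨k, hk⟩ := exists_branch_sin_nonneg hK t 1 p
        obtain ⟨l, hl⟩ := exists_branch_sin_nonpos hK t 1 p
        obtain ⟨q₁, hq₁, hq₁p, a, ha, ha'⟩ := hpos k p hp hk (hcon k)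
        obtain ⟨q₂, hq₂, hq₂p, b, hb, hb'⟩ := hneg l p hp hl (hcon l)
        refine hpZ (Or.inr ⟨p, ⟨q₁, hq₁, q₂, hq₂, ?_, hq₁p, hq₂p⟩, rfl⟩)
        rw [ha', hb']
        exact hslope _ _ (hS1 a ha) (hS1 b hb)
      have hd := abs_det_pos h
      have hcard := card_fibreGroup' h
      classical
      rw [foldFreq_succ_proj h, inv_mul_le_iff₀ hd, ← Finset.add_sum_erase _ _ (Finset.mem_univ k₀),
        hk₀, zero_add]
      refine (Finset.sum_le_card_nsmul _ _ _ fun k _ => hchild k).trans (le_of_eq ?_)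
      rw [Finset.card_erase_of_mem (Finset.mem_univ _), Finset.card_univ, nsmul_eq_mul,
        Nat.cast_sub Fintype.card_pos, hcard, pow_succ]
      field_simp
      simp

/-- For the triangle wave, the frequency of visits to the fold lines after many backward steps is
uniformly small. The finitely many exceptional points do not matter, as each of them is visited
along at most one backward orbit of each length. -/
theorem exists_foldFreq_one_lt (h : 2 < |E₁.det|) (h01 : (toReal E₁)⁻¹ 0 1 ≠ 0)
    (hK : ∃ k : fibreGroup E₁, (k : Torus) 0 ≠ 0) :
    ∃ T : ℝ, ∀ t, T ≤ t → ∀ c : ℝ, 0 < c → ∃ m, ∀ y, foldFreq E₁ t 1 m y < c := by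
  have h0 : E₁.det ≠ 0 := by rintro h0; rw [h0] at h; simp at h
  have hd : 2 < |(E₁.det : ℝ)| := by exact_mod_cast h
  have hd1 : |(E₁.det : ℝ)|⁻¹ < 1 := inv_lt_one_of_one_lt₀ (by linarith)
  have hd0 : 0 < |(E₁.det : ℝ)|⁻¹ := by positivity
  obtain ⟨T, hT⟩ := exists_lines_foldFreq h0 h01 hK
  refine ⟨T, fun t ht c hc => ?_⟩
  obtain ⟨m, hm⟩ := exists_pow_lt_of_lt_one (half_pos hc) (show 1 - |(E₁.det : ℝ)|⁻¹ < 1 by linarith)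
  obtain ⟨S, -, -, Z, hZ, hSZ⟩ := hT t ht m 2
  obtain ⟨l, hl⟩ := exists_pow_lt_of_lt_one
    (show 0 < c / 2 / (hZ.toFinset.card + 1) by positivity) hd1
  refine ⟨l + (m + 1), fun y => ?_⟩
  have hφ : ∀ y, foldFreq E₁ t 1 (m + 1) y ≤
      (1 - |(E₁.det : ℝ)|⁻¹) ^ m + ∑ z ∈ hZ.toFinset, indicator {z} 1 y := by
    intro y
    obtain ⟨p, rfl, hp⟩ := exists_bounded_lift y
    have hnn : ∀ z : Torus, (0 : ℝ) ≤ indicator {z} 1 (proj p) := fun z =>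
      indicator_nonneg (fun _ _ => zero_le_one) _
    by_cases hpZ : proj p ∈ Z
    · have h1 : (1 : ℝ) ≤ ∑ z ∈ hZ.toFinset, indicator {z} 1 (proj p) := by
        have := Finset.single_le_sum (f := fun z => (indicator {z} 1 (proj p) : ℝ))
          (fun z _ => hnn z) (hZ.mem_toFinset.2 hpZ)
        simpa using this
      have h2 : 0 ≤ (1 - |(E₁.det : ℝ)|⁻¹) ^ m := pow_nonneg (by linarith) m
      linarith [foldFreq_le_one (t := t) (r := 1) h0 (m + 1) (proj p)]
    · have h1 := (hSZ p hp).2 hpZ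
      have h2 : (0 : ℝ) ≤ ∑ z ∈ hZ.toFinset, indicator {z} 1 (proj p) :=
        Finset.sum_nonneg fun z _ => hnn z
      linarith
  have h1 := backAvg_iterate_le (t := t) (r := 1) h0 _ hZ.toFinset hφ l y
  have h2 : ∑ z ∈ hZ.toFinset, |(E₁.det : ℝ)|⁻¹ ^ l *
      indicator {(shearEndo E₁ t 1)^[l] z} 1 y ≤ hZ.toFinset.card * |(E₁.det : ℝ)|⁻¹ ^ l := by
    rw [← nsmul_eq_mul]
    refine Finset.sum_le_card_nsmul _ _ _ fun z _ => ?_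
    have : (indicator {(shearEndo E₁ t 1)^[l] z} 1 y : ℝ) ≤ 1 :=
      indicator_le_self' (f := fun _ => (1 : ℝ)) (fun _ _ => zero_le_one) y
    calc _ ≤ |(E₁.det : ℝ)|⁻¹ ^ l * 1 := by gcongr
      _ = _ := mul_one _
  rw [foldFreq, Function.iterate_add_apply]
  rw [lt_div_iff₀ (by positivity)] at hl
  have h3 : 0 < |(E₁.det : ℝ)|⁻¹ ^ l := by positivity
  change (backAvg E₁ t 1)^[l] (foldFreq E₁ t 1 (m + 1)) y < c
  linarith

/-! ### Smoothing the triangle wave -/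

theorem upperSemicontinuous_foldFreq (h : E₁.det ≠ 0) (t : ℝ) (m : ℕ) :
    UpperSemicontinuous fun q : ℝ × Plane => foldFreq E₁ t q.1 m (proj q.2) := by
  induction m with
  | zero =>
    set A : Set (ℝ × Plane) := {q | Real.sin (2 * Real.pi * q.2 0) ^ 2 ≤ 1 - q.1 ^ 2} with hA
    have hcl : IsClosed A := isClosed_le (by fun_prop) (by fun_prop)
    have h1 := hcl.upperSemicontinuous_indicator (zero_le_one (α := ℝ))
    convert h1 using 2 with q
    have hiff : proj q.2 ∈ foldSet q.1 ↔ q ∈ A := proj_mem_foldSet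
    simp only [foldFreq, Function.iterate_zero, id]
    by_cases hq : proj q.2 ∈ foldSet q.1
    · rw [indicator_of_mem hq, indicator_of_mem (hiff.1 hq), Pi.one_apply]
    · rw [indicator_of_notMem hq, indicator_of_notMem fun hh => hq (hiff.2 hh)]
  | succ m ih =>
    simp_rw [foldFreq_succ_proj h, Finset.mul_sum]
    refine upperSemicontinuous_sum fun k _ => ?_
    have hb : Continuous fun q : ℝ × Plane => (q.1, branch t q.1 k q.2) := by
      refine continuous_fst.prodMk ?_
      unfold branch
      exact (continuous_shearLift (-t)).comp (continuous_fst.prodMk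
        (((planeMap (toReal E₁)⁻¹).continuous.comp continuous_snd).add continuous_const))
    have h1 : UpperSemicontinuous fun q : ℝ × Plane =>
        foldFreq E₁ t q.1 m (proj (branch t q.1 k q.2)) := fun q c hc =>
      hb.continuousAt.eventually (ih (q.1, branch t q.1 k q.2) c hc)
    have h2 : Monotone fun x : ℝ => |(E₁.det : ℝ)|⁻¹ * x :=
      fun x y hxy => mul_le_mul_of_nonneg_left hxy (inv_nonneg.2 (abs_nonneg _))
    exact (continuous_const.mul continuous_id).comp_upperSemicontinuous h1 h2

/-- The visits to the fold remain rare when the triangle wave is replaced by a smooth profile that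
is close to it. -/
theorem exists_foldFreq_lt (h : E₁.det ≠ 0) {t c : ℝ} {m : ℕ}
    (hm : ∀ y, foldFreq E₁ t 1 m y < c) :
    ∃ r : ℝ, 0 < r ∧ r < 1 ∧ 1 / 2 ≤ r ^ 2 ∧ ∀ y, foldFreq E₁ t r m y < c := by
  have hopen : IsOpen {q : ℝ × Plane | foldFreq E₁ t q.1 m (proj q.2) < c} :=
    (upperSemicontinuous_foldFreq h t m).isOpen_preimage c
  have hsub : ({1} : Set ℝ) ×ˢ Metric.closedBall (0 : Plane) 2 ⊆
      {q : ℝ × Plane | foldFreq E₁ t q.1 m (proj q.2) < c} := by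
    rintro ⟨r, p⟩ ⟨hr, -⟩
    rw [mem_singleton_iff] at hr
    simp only at hr
    subst hr
    exact hm _
  obtain ⟨U, V, hU, -, hU1, hV, hUV⟩ := generalized_tube_lemma isCompact_singleton
    (isCompact_closedBall (0 : Plane) 2) hopen hsub
  obtain ⟨δ, hδ, hball⟩ := Metric.isOpen_iff.1 hU 1 (hU1 rfl)
  obtain ⟨r, hr0, hr1, hr2, hrU⟩ : ∃ r : ℝ, 0 < r ∧ r < 1 ∧ 1 / 2 ≤ r ^ 2 ∧ r ∈ U := by
    have h1 : 0 < min (δ / 2) (1 / 8 : ℝ) := by positivity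
    have h2 := min_le_left (δ / 2) (1 / 8 : ℝ)
    have h3 := min_le_right (δ / 2) (1 / 8 : ℝ)
    refine ⟨1 - min (δ / 2) (1 / 8), by linarith, by linarith, by nlinarith, hball ?_⟩
    rw [Metric.mem_ball, Real.dist_eq, sub_sub_cancel_left, abs_neg, abs_of_pos h1]
    linarith
  refine ⟨r, hr0, hr1, hr2, fun y => ?_⟩
  obtain ⟨p, rfl, hp⟩ := exists_bounded_lift y
  have hmem : ((r, p) : ℝ × Plane) ∈
      {q : ℝ × Plane | foldFreq E₁ t q.1 m (proj q.2) < c} :=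
    hUV (mk_mem_prod hrU (hV (mem_closedBall_zero_iff.2 hp)))
  exact hmem

end

/-! ### Growth of the backward sums -/

section growth

variable {E₁ : Matrix (Fin 2) (Fin 2) ℤ} [Fintype (fibreGroup E₁)]

/-- A visit to the fold costs an amount of order `log t`; every other step increases the average
of the potential. -/
theorem exists_potential_step_foldFreq (h : E₁.det ≠ 0) (h01 : (toReal E₁)⁻¹ 0 1 ≠ 0)
    (hK : ∃ k : fibreGroup E₁, (k : Torus) 0 ≠ 0) :
    ∃ C T : ℝ, 1 ≤ T ∧ ∀ t, T ≤ t → ∀ r : ℝ, 0 < r → r < 1 → 1 / 2 ≤ r ^ 2 →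
      ∀ p u : Plane, u ≠ 0 →
      (∀ k : fibreGroup E₁, invDeriv E₁ t (profileSlope r (branch t r k p 0)) u ≠ 0) ∧
      potential E₁ t u + (|(E₁.det : ℝ)|⁻¹ * Real.log t - C) -
          |(E₁.det : ℝ)| * (|(E₁.det : ℝ)| + 2) * Real.log t * foldFreq E₁ t r 1 (proj p) ≤
        |(E₁.det : ℝ)|⁻¹ * ∑ k : fibreGroup E₁,
          potential E₁ t (invDeriv E₁ t (profileSlope r (branch t r k p 0)) u) := by
  obtain ⟨C, T, hT, hstep⟩ := exists_potential_step h h01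
  refine ⟨C, T, hT, fun t ht r hr0 hr1 hr2 p u hu => ?_⟩
  obtain ⟨h1, h2, h3⟩ := hstep t ht (fun k => profileSlope r (branch t r k p 0))
    (fun k => abs_profileSlope_le hr0 hr1 _) u hu
  refine ⟨h1, ?_⟩
  have hff := foldFreq_succ_proj (t := t) (r := r) h 0 p
  rw [zero_add] at hff
  have hnn := foldFreq_nonneg (t := t) (r := r) h 1 (proj p)
  have hcard := card_fibreGroup' h
  set d := |(E₁.det : ℝ)| with hd
  have hd1 : 1 ≤ d := by
    rw [← hcard]
    exact_mod_cast Fintype.card_pos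
  have hL : 0 ≤ Real.log t := Real.log_nonneg (by linarith)
  by_cases hfold : ∃ k : fibreGroup E₁, proj (branch t r k p) ∈ foldSet r
  · obtain ⟨k, hk⟩ := hfold
    have h4 : d⁻¹ ≤ foldFreq E₁ t r 1 (proj p) := by
      rw [hff]
      have h5 := Finset.single_le_sum (f := fun k => foldFreq E₁ t r 0 (proj (branch t r k p)))
        (fun l _ => foldFreq_nonneg h 0 _) (Finset.mem_univ k)
      have h6 : foldFreq E₁ t r 0 (proj (branch t r k p)) = 1 :=
        indicator_of_mem hk 1
      simp only [h6] at h5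
      exact le_mul_of_one_le_right (by positivity) h5
    have h5 : d * (d + 2) * Real.log t * d⁻¹ ≤
        d * (d + 2) * Real.log t * foldFreq E₁ t r 1 (proj p) := by gcongr
    have h6 : d * (d + 2) * Real.log t * d⁻¹ = (d + 2) * Real.log t := by
      field_simp
    have h7 : d⁻¹ * Real.log t ≤ 1 * Real.log t := by
      gcongr
      exact inv_le_one_of_one_le₀ hd1
    linarith
  · push Not at hfold
    have hs : ∀ k : fibreGroup E₁,
        1 - r ^ 2 < Real.sin (2 * Real.pi * branch t r k p 0) ^ 2 := fun k =>
      not_le.1 fun hh => hfold k (proj_mem_foldSet.2 hh)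
    have hne : ∀ k : fibreGroup E₁, Real.sin (2 * Real.pi * branch t r k p 0) ≠ 0 := by
      intro k h0
      have := hs k
      rw [h0] at this
      nlinarith
    have h4 := fun k => half_le_abs_profileSlope hr0 hr1 hr2 (hs k)
    have h5 := h3 (fun k => (h4 k).1)
      (by
        obtain ⟨k, hk⟩ := exists_branch_sin_nonneg hK t r p
        exact ⟨k, nonneg_of_mul_nonneg_left (h4 k).2 (lt_of_le_of_ne hk (hne k).symm)⟩)
      (by
        obtain ⟨k, hk⟩ := exists_branch_sin_nonpos hK t r p
        refine ⟨k, ?_⟩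
        by_contra! hpos
        exact (mul_neg_of_pos_of_neg hpos (lt_of_le_of_ne hk (hne k))).not_ge (h4 k).2)
    have h6 : 0 ≤ d * (d + 2) * Real.log t * foldFreq E₁ t r 1 (proj p) := by positivity
    linarith

/-- The backward sums grow linearly, up to a loss for each visit to the fold. The constant `C` does
not depend on `t`, so that the gain is positive for large `t`. -/
theorem exists_backwardSum_conjEndo_ge (h : E₁.det ≠ 0) (h01 : (toReal E₁)⁻¹ 0 1 ≠ 0)
    (hK : ∃ k : fibreGroup E₁, (k : Torus) 0 ≠ 0) (n : ℤ) :
    ∃ C T : ℝ, 1 ≤ T ∧ ∀ t, T ≤ t → ∃ D : ℝ, ∀ r : ℝ, 0 < r → r < 1 → 1 / 2 ≤ r ^ 2 →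
      ∀ (m : ℕ) (p u : Plane), u ≠ 0 →
      Real.log (sumNorm u) - D + m * (|(E₁.det : ℝ)|⁻¹ * Real.log t - C) -
          |(E₁.det : ℝ)| * (|(E₁.det : ℝ)| + 2) * Real.log t *
            ∑ i ∈ Finset.range m, foldFreq E₁ t r (i + 1) (proj p) ≤
        backwardSum (conjEndo E₁ n t r)^[m] (proj (planeMap (toReal (basisChange n)) p))
          (planeMap (toReal (basisChange n)) u) := by
  obtain ⟨C, T, hT, hstep⟩ := exists_potential_step_foldFreq h h01 hK
  obtain ⟨B, hB, hBu⟩ := exists_sumNorm_planeMap_le (toReal (basisChangeInv n))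
  refine ⟨C, T, hT, fun t ht => ?_⟩
  have hL : 0 ≤ Real.log t := Real.log_nonneg (by linarith)
  have hd := abs_det_pos h
  have hcard := card_fibreGroup' h
  refine ⟨Real.log (2 * B) + |(E₁.det : ℝ)| * Real.log t, fun r hr0 hr1 hr2 => ?_⟩
  set d := |(E₁.det : ℝ)| with hd'
  set δ := d⁻¹ * Real.log t - C with hδ
  set C' := d * (d + 2) * Real.log t with hC'
  set D := Real.log (2 * B) + d * Real.log t with hD
  have hdL : 0 ≤ d * Real.log t := by positivity
  suffices hmain : ∀ (m : ℕ) (p u : Plane), u ≠ 0 → potential E₁ t u - D + m * δ -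
      C' * ∑ i ∈ Finset.range m, foldFreq E₁ t r (i + 1) (proj p) ≤
        backwardSum (conjEndo E₁ n t r)^[m] (proj (planeMap (toReal (basisChange n)) p))
          (planeMap (toReal (basisChange n)) u) by
    intro m p u hu
    refine le_trans ?_ (hmain m p u hu)
    unfold potential
    split_ifs <;> linarith
  intro m
  induction m with
  | zero =>
    intro p u hu
    rw [backwardSum_zero]
    have h1 : sumNorm u ≤ 2 * B * ‖planeMap (toReal (basisChange n)) u‖ := by
      have e1 := hBu (planeMap (toReal (basisChange n)) u)
      rw [planeMap_inv_basisChange] at e1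
      have e2 := mul_le_mul_of_nonneg_left
        (sumNorm_le_norm (planeMap (toReal (basisChange n)) u)) hB.le
      linarith
    have h2 : 0 < ‖planeMap (toReal (basisChange n)) u‖ := by
      have := (sumNorm_pos hu).trans_le h1
      exact pos_of_mul_pos_right this (by positivity)
    have h3 := Real.log_le_log (sumNorm_pos hu) h1
    rw [Real.log_mul (by positivity) h2.ne'] at h3
    simp only [Nat.cast_zero, zero_mul, add_zero, Finset.range_zero, Finset.sum_empty, mul_zero,
      sub_zero]
    unfold potential
    rw [← hd', hD]
    split_ifs <;> linarith
  | succ m ih =>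
    intro p u hu
    obtain ⟨h1, h2⟩ := hstep t ht r hr0 hr1 hr2 p u hu
    rw [backwardSum_conjEndo_succ h n t hr0 hr1 m p u]
    have h3 : d⁻¹ * ∑ k : fibreGroup E₁,
        (potential E₁ t (invDeriv E₁ t (profileSlope r (branch t r k p 0)) u) - D + m * δ -
          C' * ∑ i ∈ Finset.range m, foldFreq E₁ t r (i + 1) (proj (branch t r k p))) ≤
        d⁻¹ * ∑ k : fibreGroup E₁, backwardSum (conjEndo E₁ n t r)^[m]
          (proj (planeMap (toReal (basisChange n)) (branch t r k p)))
          (planeMap (toReal (basisChange n))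
            (invDeriv E₁ t (profileSlope r (branch t r k p 0)) u)) := by
      gcongr with k
      exact ih _ _ (h1 k)
    refine le_trans ?_ h3
    have h4 : d⁻¹ * ∑ k : fibreGroup E₁,
        (potential E₁ t (invDeriv E₁ t (profileSlope r (branch t r k p 0)) u) - D + m * δ -
          C' * ∑ i ∈ Finset.range m, foldFreq E₁ t r (i + 1) (proj (branch t r k p))) =
        d⁻¹ * ∑ k : fibreGroup E₁,
          potential E₁ t (invDeriv E₁ t (profileSlope r (branch t r k p 0)) u) - D + m * δ -
        C' * ∑ i ∈ Finset.range m, foldFreq E₁ t r (i + 1 + 1) (proj p) := by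
      simp_rw [foldFreq_succ_proj (t := t) (r := r) h (_ + 1) p]
      rw [← Finset.mul_sum, Finset.sum_comm (s := Finset.range m)]
      simp only [Finset.sum_add_distrib, Finset.sum_sub_distrib, Finset.sum_const,
        Finset.card_univ, nsmul_eq_mul, hcard, ← Finset.mul_sum]
      rw [← hd']
      field_simp
    rw [h4, Finset.sum_range_succ']
    push_cast
    linarith

end growth

/-! ### The conjugated maps are conservative local diffeomorphisms -/

theorem contDiff_conjLift (E₁ : Matrix (Fin 2) (Fin 2) ℤ) (n : ℤ) (t : ℝ) {r : ℝ}
    (hr0 : 0 < r) (hr1 : r < 1) :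
    ContDiff ℝ 1 fun q : ℝ × Plane => conjLift E₁ n (q.1 * t) r q.2 := by
  have h1 : ContDiff ℝ 1 fun q : ℝ × Plane =>
      (q.1 * t, planeMap (toReal (basisChangeInv n)) q.2) :=
    (contDiff_fst.mul contDiff_const).prodMk
      ((planeMap (toReal (basisChangeInv n))).contDiff.comp contDiff_snd)
  exact (planeMap (toReal (basisChange n * E₁))).contDiff.comp
    ((contDiff_shearLift hr0 hr1).comp h1)

theorem conjEndo_mem_EndMu1 {E₁ : Matrix (Fin 2) (Fin 2) ℤ} (h : E₁.det ≠ 0) (n : ℤ) (t : ℝ)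
    {r : ℝ} (hr0 : 0 < r) (hr1 : r < 1) : conjEndo E₁ n t r ∈ EndMu1 := by
  refine ⟨⟨conjLift E₁ n t r, ?_, conjEndo_proj E₁ n t r⟩, fun x => ?_, ?_⟩
  · have h1 := (contDiff_conjLift E₁ n t hr0 hr1).comp
      (contDiff_const (c := (1 : ℝ)).prodMk (contDiff_id (E := Plane)))
    simpa [Function.comp_def] using h1
  · obtain ⟨v, rfl⟩ := proj_surjective x
    have hD := hasFDerivAt_conjLift E₁ n t hr0 hr1 v
    rw [torusDeriv_proj (conjEndo_proj E₁ n t r) hD.differentiableAt, hD.fderiv, det_planeMap,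
      Matrix.det_mul, Matrix.det_mul, toReal_det, toReal_det, Matrix.det_mul, det_basisChange,
      det_basisChangeInv]
    have hs : ∀ σ, (shearMatrix t σ).det = 1 := fun σ => by simp [shearMatrix, Matrix.det_fin_two]
    rw [hs]
    simpa using h
  · exact (measurePreserving_linearEndo (by rw [det_basisChange]; exact one_ne_zero)).comp
      (((measurePreserving_linearEndo h).comp (measurePreserving_shear t r)).comp
        (measurePreserving_linearEndo (by rw [det_basisChangeInv]; exact one_ne_zero)))

theorem conjEndo_mem_homotopyClass (E : Matrix (Fin 2) (Fin 2) ℤ) (n : ℤ) (t : ℝ) {r : ℝ}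
    (hr0 : 0 < r) (hr1 : r < 1) :
    conjEndo (basisChangeInv n * E * basisChange n) n t r ∈ homotopyClass (linearEndo E) := by
  refine ⟨fun s => conjEndo (basisChangeInv n * E * basisChange n) n (s * t) r,
    ⟨fun q => conjLift (basisChangeInv n * E * basisChange n) n (q.1 * t) r q.2,
      (contDiff_conjLift _ n t hr0 hr1).contDiffOn, fun s _ v => conjEndo_proj _ n _ r v⟩, ?_, ?_⟩
  · funext x
    simp only [zero_mul]
    rw [conjEndo, shearEndo, shear_zero_left, ← linearEndo_mul, ← linearEndo_mul]
    congr 1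
    calc basisChange n * (basisChangeInv n * E * basisChange n) * basisChangeInv n
        = (basisChange n * basisChangeInv n) * E * (basisChange n * basisChangeInv n) := by
          simp only [mul_assoc]
      _ = E := by rw [basisChange_mul_inv, one_mul, mul_one]
  · simp only [one_mul]

theorem toReal_inv_apply_zero {A : Matrix (Fin 2) (Fin 2) ℤ} :
    (toReal A)⁻¹ 0 0 = A 1 1 / A.det ∧ (toReal A)⁻¹ 0 1 = -A 0 1 / A.det := by
  rw [Matrix.inv_def, toReal_det, Matrix.adjugate_fin_two, Ring.inverse_eq_inv']
  constructor
  · simp [div_eq_inv_mul]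
  · simp [div_eq_inv_mul]

/-- The kernel contains the classes of the columns of the inverse matrix. -/
theorem exists_fibreGroup_apply_zero_ne {A : Matrix (Fin 2) (Fin 2) ℤ} (h : A.det ≠ 0)
    (hA : ¬ (A.det ∣ A 0 1 ∧ A.det ∣ A 1 1)) : ∃ k : fibreGroup A, (k : Torus) 0 ≠ 0 := by
  by_contra! hcon
  have hD : (A.det : ℝ) ≠ 0 := Int.cast_ne_zero.2 h
  have key : ∀ j, ∃ z : ℤ, (z : ℝ) = (toReal A)⁻¹ 0 j := by
    intro j
    have hmem : proj (planeMap (toReal A)⁻¹ (EuclideanSpace.single j 1)) ∈ fibreGroup A := by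
      rw [mem_fibreGroup, linearEndo_proj, planeMap_toReal_inv h]
      ext i
      rw [Pi.zero_apply]
      refine (coe_eq_zero_iff _).2 ?_
      by_cases hij : i = j
      · exact ⟨1, by simp [hij]⟩
      · exact ⟨0, by simp [hij]⟩
    have := hcon ⟨_, hmem⟩
    obtain ⟨z, hz⟩ := (coe_eq_zero_iff _).1 this
    refine ⟨z, hz.trans ?_⟩
    rw [planeMap_apply]
    fin_cases j <;> simp
  obtain ⟨z, hz⟩ := key 0
  obtain ⟨w, hw⟩ := key 1
  rw [toReal_inv_apply_zero.1, eq_div_iff hD] at hz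
  rw [toReal_inv_apply_zero.2, eq_div_iff hD] at hw
  refine hA ⟨⟨-w, ?_⟩, ⟨z, ?_⟩⟩
  · have : w * A.det = -A 0 1 := by exact_mod_cast hw
    linarith
  · have : z * A.det = A 1 1 := by exact_mod_cast hz
    linarith

/-! ### Positivity of the exponent -/

theorem Cchi_pos_of_le {f : Torus → Torus} {m : ℕ} (hm : 1 ≤ m)
    (hf : ∀ x u, ‖u‖ = 1 → 1 ≤ backwardSum f^[m] x u) : 0 < Cchi f := by
  have hm0 : (0 : ℝ) < 1 / m := by
    have : (1 : ℝ) ≤ m := by exact_mod_cast hm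
    positivity
  calc (0 : EReal) < ((1 / (m : ℝ) : ℝ) : EReal) := by exact_mod_cast hm0
    _ ≤ ⨅ (x : Torus) (u : Plane) (_ : ‖u‖ = 1),
        (((1 / (m : ℝ)) * backwardSum (f^[m]) x u : ℝ) : EReal) := by
      refine le_iInf fun x => le_iInf fun u => le_iInf fun hu => ?_
      exact EReal.coe_le_coe_iff.2 (le_mul_of_one_le_right hm0.le (hf x u hu))
    _ ≤ Cchi f := le_iSup₂ (f := fun (n : ℕ) (_ : 1 ≤ n) =>
        ⨅ (x : Torus) (u : Plane) (_ : ‖u‖ = 1),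
          (((1 / (n : ℝ)) * backwardSum (f^[n]) x u : ℝ) : EReal)) m hm

/-- The constants are chosen one after the other: `t` for a large gain per step, then the admissible
frequency of visits to the fold, which depends on `t`, and finally the smooth profile. -/
theorem exists_conjEndo_mem_setU {E₁ : Matrix (Fin 2) (Fin 2) ℤ} (h : 2 < |E₁.det|)
    (h01 : (toReal E₁)⁻¹ 0 1 ≠ 0) (hK : ∃ k : fibreGroup E₁, (k : Torus) 0 ≠ 0) (n : ℤ) :
    ∃ t r : ℝ, 0 < r ∧ r < 1 ∧ conjEndo E₁ n t r ∈ setU := by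
  have h0 : E₁.det ≠ 0 := by rintro h0; rw [h0] at h; simp at h
  have := finite_fibreGroup h0
  have := Fintype.ofFinite (fibreGroup E₁)
  have hd := abs_det_pos h0
  obtain ⟨C, T, hT, hgrow⟩ := exists_backwardSum_conjEndo_ge h0 h01 hK n
  obtain ⟨T', hfreq⟩ := exists_foldFreq_one_lt h h01 hK
  obtain ⟨B, hB, hBu⟩ := exists_sumNorm_planeMap_le (toReal (basisChange n))
  set d := |(E₁.det : ℝ)| with hd'
  -- the gain `log t / d - C` per step is at least `1`
  set t := max (max T T') (Real.exp (d * (C + 1))) with ht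
  have ht1 : T ≤ t := (le_max_left _ _).trans (le_max_left _ _)
  have ht2 : T' ≤ t := (le_max_right _ _).trans (le_max_left _ _)
  have hL : d * (C + 1) ≤ Real.log t := by
    rw [← Real.log_exp (d * (C + 1))]
    exact Real.log_le_log (Real.exp_pos _) (le_max_right _ _)
  have hδ : 1 ≤ d⁻¹ * Real.log t - C := by
    rw [inv_mul_eq_div, le_sub_iff_add_le, le_div_iff₀ hd]
    linarith
  have hL0 : 0 ≤ Real.log t := Real.log_nonneg (hT.trans ht1)
  obtain ⟨D, hD⟩ := hgrow t ht1
  set C' := d * (d + 2) * Real.log t with hC'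
  have hC0 : 0 ≤ C' := by positivity
  -- with this frequency of visits to the fold, the loss per step is at most `1 / 2`
  obtain ⟨M, hM⟩ := hfreq t ht2 (1 / (2 * (C' + 1))) (by positivity)
  obtain ⟨r, hr0, hr1, hr2, hr⟩ := exists_foldFreq_lt h0 hM
  refine ⟨t, r, hr0, hr1, conjEndo_mem_EndMu1 h0 n t hr0 hr1, ?_⟩
  set c := 1 / (2 * (C' + 1)) with hc
  have hc0 : 0 < c := by positivity
  have hC'c : C' * c ≤ 1 / 2 := by
    rw [hc, mul_one_div, div_le_div_iff₀ (by positivity) (by norm_num)]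
    linarith
  -- the frequency is at most `1` in the first `M` steps, and at most `c` from then on
  have hsum : ∀ (m : ℕ) (y : Torus),
      ∑ i ∈ Finset.range m, foldFreq E₁ t r (i + 1) y ≤ M + m * c := by
    intro m y
    have h1 : ∀ i ∈ Finset.range m, foldFreq E₁ t r (i + 1) y ≤
        (if i < M then 1 else 0) + c := by
      intro i _
      split_ifs with hi
      · linarith [foldFreq_le_one (t := t) (r := r) h0 (i + 1) y]
      · rw [zero_add]
        exact foldFreq_le_of_le h0 (fun y => (hr y).le) (by omega) y
    refine (Finset.sum_le_sum h1).trans ?_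
    rw [Finset.sum_add_distrib, Finset.sum_const, Finset.card_range, nsmul_eq_mul,
      Finset.sum_boole]
    gcongr
    calc _ ≤ (Finset.range M).card := Finset.card_le_card fun i hi => by
          simp only [Finset.mem_filter] at hi
          exact Finset.mem_range.2 hi.2
      _ = M := Finset.card_range M
  obtain ⟨m, hm⟩ := exists_nat_ge (2 * (1 + Real.log B + D + C' * M))
  refine Cchi_pos_of_le (m := m + 1) (by omega) fun x u hu => ?_
  obtain ⟨v, rfl⟩ := proj_surjective x
  set p := planeMap (toReal (basisChangeInv n)) v with hp
  set w := planeMap (toReal (basisChangeInv n)) u with hw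
  have hpv : planeMap (toReal (basisChange n)) p = v := planeMap_basisChange_inv n v
  have hwu : planeMap (toReal (basisChange n)) w = u := planeMap_basisChange_inv n u
  have hw1 : 1 ≤ B * sumNorm w := by
    have h1 := hBu w
    rw [hwu] at h1
    linarith [norm_le_sumNorm u]
  have hw2 : 0 < sumNorm w := pos_of_mul_pos_right (zero_lt_one.trans_le hw1) hB.le
  have hw3 : 0 ≤ Real.log B + Real.log (sumNorm w) := by
    rw [← Real.log_mul hB.ne' hw2.ne']
    exact Real.log_nonneg hw1
  have hmain := hD r hr0 hr1 hr2 (m + 1) p w (ne_zero_of_sumNorm_pos hw2)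
  rw [hpv, hwu] at hmain
  refine le_trans ?_ hmain
  have h1 := mul_le_mul_of_nonneg_left (hsum (m + 1) (proj p)) hC0
  have h2 := mul_le_mul_of_nonneg_left hδ (Nat.cast_nonneg (α := ℝ) (m + 1))
  have h3 := mul_le_mul_of_nonneg_left hC'c (Nat.cast_nonneg (α := ℝ) (m + 1))
  push_cast at h1 h2 h3 ⊢
  nlinarith

end TorusEndo

end

theorem mainTheorem3 (E : Matrix (Fin 2) (Fin 2) ℤ) (hE : ¬ TorusEndo.IsHomothety E)
    (hdet : 2 < |E.det|) :
    (TorusEndo.homotopyClass (TorusEndo.linearEndo E) ∩ TorusEndo.setU).Nonempty := by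
  open TorusEndo in
  obtain ⟨n, hn, hn'⟩ := exists_basisChange hE hdet
  have hdetE : (basisChangeInv n * E * basisChange n).det = E.det := by
    rw [Matrix.det_mul, Matrix.det_mul, det_basisChange, det_basisChangeInv, one_mul, mul_one]
  rw [← hdetE] at hdet hn'
  have h0 : (basisChangeInv n * E * basisChange n).det ≠ 0 := by
    intro h0; rw [h0] at hdet; simp at hdet
  have h01 : (toReal (basisChangeInv n * E * basisChange n))⁻¹ 0 1 ≠ 0 := by
    rw [toReal_inv_apply_zero.2]
    exact div_ne_zero (neg_ne_zero.2 (Int.cast_ne_zero.2 hn)) (Int.cast_ne_zero.2 h0)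
  obtain ⟨t, r, hr0, hr1, hU⟩ :=
    exists_conjEndo_mem_setU hdet h01 (exists_fibreGroup_apply_zero_ne h0 hn') n
  exact ⟨_, conjEndo_mem_homotopyClass E n t hr0 hr1, hU⟩
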